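/- Call a digraph simple if it has no loops and no multiple edges (a pair of opposite edges $u\to v$, $v\to u$ is allowed). Call it strongly connected if there is a directed path from every vertex to every vertex, and $k$-strongly connected if it has more than $k$ vertices and remains strongly connected after deletion of any set of fewer than $k$ vertices. Theorem. Let $k_1,k_2\ge 2$ be fixed integers, $k=\min\{k_1,k_2\}$, and let $\varepsilon>0$ and $C>0$ be fixed. Then there are constants $K$ and $N_0$, depending only on $k_1,k_2,\varepsilon,C$, such that for all integers $N\ge N_0$ and $M$ with $$(\max\{k_1,k_2\}+\varepsilon)\,N\le M\le C\,N$$ the following holds. There exist simple digraphs on the vertex set $[N]$ with exactly $M$ directed edges, all of whose in-degrees are at least $k_1$ and all of whose out-degrees are at least $k_2$; and if $D$ is chosen uniformly at random among all of them, then $$P\bigl(D\text{ is strongly connected}\bigr)\ge 1-K N^{-2(k-1)},\qquad P\bigl(D\text{ is } k\text{-strongly connected}\bigr)\ge 1-K N^{-(k-1)}.$$ -/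

import Mathlib

namespace Digraph

variable {V : Type*}

/-- A simple digraph: no loops (parallel edges are impossible in `Digraph V`,
and the two opposite edges `u → v`, `v → u` may both be present). -/
def IsSimple (D : Digraph V) : Prop := ∀ v, ¬ D.Adj v v

/-- The set of directed edges, as ordered pairs (tail, head). -/
def edges (D : Digraph V) : Set (V × V) := {e | D.Adj e.1 e.2}

/-- In-degree of a vertex. -/
noncomputable def inDeg (D : Digraph V) (v : V) : ℕ := {u | D.Adj u v}.ncard

/-- Out-degree of a vertex. -/
noncomputable def outDeg (D : Digraph V) (v : V) : ℕ := {u | D.Adj v u}.ncard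

/-- A directed `(k₁, k₂)`-core: every in-degree is at least `k₁` and every out-degree is at
least `k₂`. -/
def IsDicore (k₁ k₂ : ℕ) (D : Digraph V) : Prop :=
  ∀ v, k₁ ≤ D.inDeg v ∧ k₂ ≤ D.outDeg v

/-- Strong connectivity: from every vertex there is a directed path to every vertex. -/
def IsStronglyConnected (D : Digraph V) : Prop :=
  ∀ u v, Relation.ReflTransGen D.Adj u v

/-- The digraph obtained by deleting the vertices in `T` with all incident edges. -/
def deleteVertices (D : Digraph V) (T : Finset V) : Digraph {v : V // v ∉ T} where
  Adj u v := D.Adj u v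

/-- `k`-strong connectivity: there are more than `k` vertices, and the digraph remains strongly
connected after the deletion of any fewer than `k` vertices. -/
def IsKStronglyConnected (k : ℕ) (D : Digraph V) : Prop :=
  k < Nat.card V ∧ ∀ T : Finset V, T.card < k → (D.deleteVertices T).IsStronglyConnected

end Digraph

/-- The set of all simple `(k₁, k₂)`-dicores on `N` labelled vertices with `M` directed edges. -/
def simpleDicores (k₁ k₂ N M : ℕ) : Set (Digraph (Fin N)) :=
  {D | D.IsSimple ∧ D.IsDicore k₁ k₂ ∧ D.edges.ncard = M}

/-- The probability that a uniformly random simple `(k₁, k₂)`-dicore on `N` labelled vertices with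
`M` directed edges has the property `P`. -/
noncomputable def dicoreProb (k₁ k₂ N M : ℕ) (P : Digraph (Fin N) → Prop) : ℝ :=
  ({D ∈ simpleDicores k₁ k₂ N M | P D}.ncard : ℝ) / ((simpleDicores k₁ k₂ N M).ncard : ℝ)

namespace DirectedCore

open Finset

/-! All probabilities are estimated by switchings: one or two edges of a core are replaced so that
the result is again a core, and counting pairs (core, switching) from both sides compares the sizes
of two classes of cores (`card_mul_le_of_exchange`). Write `k` for `min k₁ k₂`.

Switching an edge away shows that, given the presence of `F`, a further prescribed edge is present
with conditional probability O(1/N). Hence `f` prescribed edges are present with probability at most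
(a/N)^f (`pow_mul_card_coreSetsContaining_le`). A union bound then makes three local events rare, in
the core and in its reversal: a set of between 2 and linearly many vertices that can be left only
through `s` vertices; a set of `2 * w` vertices with at most `w` further out-neighbours, `w` linear
in N; a degree of order √N. The last two are rarer than any power of N. The first is dominated by
sets of two vertices: N² pairs, N^s sets of exits and `2 * k` edges of probability O(1/N) each give
N^(s - 2(k-1)).

Outside these events, delete a set `T` of at most `s < k` vertices and explore forwards from `u` and
backwards from `v`. Both explorations find linearly many vertices and have linear frontiers. If `v`
cannot be reached, the explored regions are disjoint and no edge crosses from one frontier to the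
other. Swapping an edge that leaves the first frontier with one that enters the second creates a
crossing edge and leaves both explorations unchanged. There are order N² such swaps and each result
arises from O(N) of them, so each of the passages from `j` to `j + 1` crossing edges gains a factor
O(1/N) (`card_separated_zero_le`). After `2 * k` passages the bound N^(-2k) pays for the N^(s+2)
choices of `T`, `u`, `v` and leaves N^(s - 2(k-1)) once more. The values `s = 0` and `s = k - 1`
give the two claims. -/

lemma card_filter_singleton' {α : Type*} (a : α) (p : α → Prop) [DecidablePred p] :
    #(({a} : Finset α).filter p) = if p a then 1 else 0 := by
  rw [filter_singleton]
  split_ifs <;> simp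

/-! ### Exchanges of elements of a finite set and double counting -/

section Exchange

variable {α ι : Type*} [DecidableEq α]

/-- Remove the elements of `R` from `E` and add those of `A`. -/
def exchange (E R A : Finset α) : Finset α := (E \ R) ∪ A

lemma exchange_exchange {E R A : Finset α} (hR : R ⊆ E) (hA : Disjoint E A) :
    exchange (exchange E R A) A R = E := by
  ext x
  have h1 := @hR x
  have h2 : x ∈ E → x ∉ A := fun h => Finset.disjoint_left.1 hA h
  simp only [exchange, mem_union, mem_sdiff]
  tauto

lemma card_filter_exchange {E R A : Finset α} (hR : R ⊆ E) (hA : Disjoint E A)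
    (p : α → Prop) [DecidablePred p] :
    #((exchange E R A).filter p) + #(R.filter p) = #(E.filter p) + #(A.filter p) := by
  have h1 : (exchange E R A).filter p = (E.filter p \ R.filter p) ∪ A.filter p := by
    ext x
    simp only [exchange, mem_union, mem_sdiff, mem_filter]
    tauto
  have h2 : Disjoint (E.filter p \ R.filter p) (A.filter p) :=
    Finset.disjoint_of_subset_left (sdiff_subset.trans (filter_subset _ _))
      (Finset.disjoint_of_subset_right (filter_subset _ _) hA)
  have h3 : R.filter p ⊆ E.filter p := filter_subset_filter _ hR
  rw [h1, card_union_of_disjoint h2, card_sdiff_of_subset h3]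
  have := card_le_card h3
  omega

lemma card_exchange {E R A : Finset α} (hR : R ⊆ E) (hA : Disjoint E A) :
    #(exchange E R A) + #R = #E + #A := by
  simpa using card_filter_exchange hR hA (fun _ => True)

lemma subset_exchange {E R A F : Finset α} (hF : F ⊆ E) (hR : Disjoint F R) :
    F ⊆ exchange E R A := by
  intro x hx
  exact mem_union_left _ (mem_sdiff.2 ⟨hF hx, Finset.disjoint_left.1 hR hx⟩)

/-- Double counting of exchanges: every set in `s` admits at least `m` exchanges leading into `t`,
and every set in `t` arises from at most `n` of them. -/
lemma card_mul_le_of_exchange (s t : Finset (Finset α)) (P Q : Finset α → Finset ι)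
    (rem add : ι → Finset α)
    (h : ∀ E ∈ s, ∀ p ∈ P E, rem p ⊆ E ∧ Disjoint E (add p) ∧
      exchange E (rem p) (add p) ∈ t ∧ p ∈ Q (exchange E (rem p) (add p)))
    {m n : ℕ} (hm : ∀ E ∈ s, m ≤ #(P E)) (hn : ∀ E ∈ t, #(Q E) ≤ n) :
    #s * m ≤ #t * n := by
  calc #s * m = ∑ E ∈ s, m := by simp
    _ ≤ ∑ E ∈ s, #(P E) := sum_le_sum hm
    _ = #(s.sigma fun E => P E) := (card_sigma _ _).symm
    _ ≤ #(t.sigma fun E => Q E) := by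
        refine card_le_card_of_injOn
          (fun x => ⟨exchange x.1 (rem x.2) (add x.2), x.2⟩) ?_ ?_
        · rintro ⟨E, p⟩ hx
          obtain ⟨hE, hp⟩ := mem_sigma.1 hx
          obtain ⟨-, -, h3, h4⟩ := h E hE p hp
          exact mem_sigma.2 ⟨h3, h4⟩
        · rintro ⟨E, p⟩ hx ⟨E', p'⟩ hx' heq
          obtain ⟨hE, hp⟩ := mem_sigma.1 hx
          obtain ⟨hE', hp'⟩ := mem_sigma.1 hx'
          simp only [Sigma.mk.injEq, heq_eq_eq] at heq
          obtain ⟨h1, h2⟩ := heq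
          simp only at hE hp hE' hp' h1 h2
          subst h2
          -- Injectivity: the reverse exchange recovers the original set from the image and the
          -- label.
          have e1 := exchange_exchange (h E hE p hp).1 (h E hE p hp).2.1
          have e2 := exchange_exchange (h E' hE' p hp').1 (h E' hE' p hp').2.1
          rw [h1, e2] at e1
          rw [e1]
    _ = ∑ E ∈ t, #(Q E) := card_sigma _ _
    _ ≤ ∑ E ∈ t, n := sum_le_sum hn
    _ = #t * n := by simp

lemma card_filter_pair {a b : α} (hab : a ≠ b) (p : α → Prop) [DecidablePred p] :
    #(({a, b} : Finset α).filter p) = (if p a then 1 else 0) + (if p b then 1 else 0) := by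
  rw [filter_insert, filter_singleton]
  split_ifs <;> simp [hab]

end Exchange

/-! ### Cores as finite edge sets -/

section Core

variable {V : Type*} [DecidableEq V]

/-- The number of edges of `E` with tail `u`. -/
def outDegree (E : Finset (V × V)) (u : V) : ℕ := #(E.filter fun e => e.1 = u)

/-- The number of edges of `E` with head `v`. -/
def inDegree (E : Finset (V × V)) (v : V) : ℕ := #(E.filter fun e => e.2 = v)

lemma outDegree_exchange {E R A : Finset (V × V)} (hR : R ⊆ E) (hA : Disjoint E A) (w : V) :
    outDegree (exchange E R A) w + #(R.filter fun e => e.1 = w) =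
      outDegree E w + #(A.filter fun e => e.1 = w) :=
  card_filter_exchange hR hA _

lemma inDegree_exchange {E R A : Finset (V × V)} (hR : R ⊆ E) (hA : Disjoint E A) (w : V) :
    inDegree (exchange E R A) w + #(R.filter fun e => e.2 = w) =
      inDegree E w + #(A.filter fun e => e.2 = w) :=
  card_filter_exchange hR hA _

lemma card_filter_snd_mem (E : Finset (V × V)) (S : Finset V) :
    #(E.filter fun e => e.2 ∈ S) = ∑ v ∈ S, inDegree E v := by
  rw [card_eq_sum_card_fiberwise (f := Prod.snd) (t := S)]
  · refine sum_congr rfl fun v hv => ?_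
    rw [inDegree, filter_filter]
    congr 1
    ext e
    simp only [mem_filter]
    constructor
    · rintro ⟨h1, h2, h3⟩; exact ⟨h1, h3⟩
    · rintro ⟨h1, h3⟩; exact ⟨h1, by rwa [h3], h3⟩
  · intro e he; exact (mem_filter.1 he).2

lemma card_filter_fst_mem (E : Finset (V × V)) (S : Finset V) :
    #(E.filter fun e => e.1 ∈ S) = ∑ v ∈ S, outDegree E v := by
  rw [card_eq_sum_card_fiberwise (f := Prod.fst) (t := S)]
  · refine sum_congr rfl fun v hv => ?_
    rw [outDegree, filter_filter]
    congr 1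
    ext e
    simp only [mem_filter]
    constructor
    · rintro ⟨h1, h2, h3⟩; exact ⟨h1, h3⟩
    · rintro ⟨h1, h3⟩; exact ⟨h1, by rwa [h3], h3⟩
  · intro e he; exact (mem_filter.1 he).2

variable [Fintype V]

variable (V) in
/-- The edge sets of simple `(k₁, k₂)`-dicores on `V` with `M` edges. -/
def coreSets (k₁ k₂ M : ℕ) : Finset (Finset (V × V)) :=
  univ.filter fun E => (∀ e ∈ E, e.1 ≠ e.2) ∧
    (∀ v, k₁ ≤ inDegree E v ∧ k₂ ≤ outDegree E v) ∧ #E = M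

lemma mem_coreSets {k₁ k₂ M : ℕ} {E : Finset (V × V)} :
    E ∈ coreSets V k₁ k₂ M ↔ (∀ e ∈ E, e.1 ≠ e.2) ∧
      (∀ v, k₁ ≤ inDegree E v ∧ k₂ ≤ outDegree E v) ∧ #E = M := by
  simp [coreSets]

lemma exchange_mem_coreSets {k₁ k₂ M : ℕ} {E R A : Finset (V × V)}
    (hE : E ∈ coreSets V k₁ k₂ M) (hR : R ⊆ E) (hA : Disjoint E A) (hRA : #R = #A)
    (hloop : ∀ e ∈ A, e.1 ≠ e.2)
    (hin : ∀ w, k₁ + #(R.filter fun e => e.2 = w) ≤ inDegree E w + #(A.filter fun e => e.2 = w))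
    (hout : ∀ w, k₂ + #(R.filter fun e => e.1 = w) ≤
      outDegree E w + #(A.filter fun e => e.1 = w)) :
    exchange E R A ∈ coreSets V k₁ k₂ M := by
  obtain ⟨h1, h2, h3⟩ := mem_coreSets.1 hE
  refine mem_coreSets.2 ⟨?_, ?_, ?_⟩
  · intro e he
    rcases mem_union.1 he with he | he
    · exact h1 e (mem_sdiff.1 he).1
    · exact hloop e he
  · intro w
    have a1 := card_filter_exchange hR hA (fun e => e.2 = w)
    have a2 := card_filter_exchange hR hA (fun e => e.1 = w)
    have a3 := hin w
    have a4 := hout w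
    simp only [inDegree, outDegree] at *
    constructor <;> omega
  · have := card_exchange hR hA
    omega

lemma outDegree_eq_card (E : Finset (V × V)) (u : V) :
    outDegree E u = #(univ.filter fun y => (u, y) ∈ E) := by
  rw [outDegree]
  symm
  refine card_bij (fun y _ => (u, y)) ?_ ?_ ?_
  · intro y hy; simpa using hy
  · intro a _ b _ h; simpa using h
  · rintro ⟨a, b⟩ h
    simp only [mem_filter] at h
    obtain ⟨h, rfl⟩ := h
    exact ⟨b, by simpa using h, rfl⟩

lemma inDegree_eq_card (E : Finset (V × V)) (v : V) :
    inDegree E v = #(univ.filter fun x => (x, v) ∈ E) := by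
  rw [inDegree]
  symm
  refine card_bij (fun y _ => (y, v)) ?_ ?_ ?_
  · intro y hy; simpa using hy
  · intro a _ b _ h; simpa using h
  · rintro ⟨a, b⟩ h
    simp only [mem_filter] at h
    obtain ⟨h, rfl⟩ := h
    exact ⟨a, by simpa using h, rfl⟩

end Core

/-! ### Prescribed edges are present with probability O(1/N) each -/

section EdgeBound

variable {V : Type*} [DecidableEq V] [Fintype V] {k₁ k₂ M : ℕ}

lemma card_non_outNeighbors (E : Finset (V × V)) (u : V) :
    Fintype.card V ≤ #(univ.filter fun y => (u, y) ∉ E ∧ y ≠ u) + outDegree E u + 1 := by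
  have h : (univ : Finset V) ⊆ (univ.filter fun y => (u, y) ∉ E ∧ y ≠ u) ∪
      (univ.filter fun y => (u, y) ∈ E) ∪ {u} := by
    intro y _
    simp only [mem_union, mem_filter, mem_univ, true_and, mem_singleton]
    tauto
  have h1 := card_le_card h
  have h2 := card_union_le ((univ.filter fun y => (u, y) ∉ E ∧ y ≠ u) ∪
      (univ.filter fun y => (u, y) ∈ E)) {u}
  have h3 := card_union_le (univ.filter fun y => (u, y) ∉ E ∧ y ≠ u)
      (univ.filter fun y => (u, y) ∈ E)
  rw [← outDegree_eq_card] at h3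
  rw [card_univ] at h1
  rw [card_singleton] at h2
  omega

lemma card_non_inNeighbors (E : Finset (V × V)) (v : V) :
    Fintype.card V ≤ #(univ.filter fun x => (x, v) ∉ E ∧ x ≠ v) + inDegree E v + 1 := by
  have h : (univ : Finset V) ⊆ (univ.filter fun y => (y, v) ∉ E ∧ y ≠ v) ∪
      (univ.filter fun y => (y, v) ∈ E) ∪ {v} := by
    intro y _
    simp only [mem_union, mem_filter, mem_univ, true_and, mem_singleton]
    tauto
  have h1 := card_le_card h
  have h2 := card_union_le ((univ.filter fun y => (y, v) ∉ E ∧ y ≠ v) ∪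
      (univ.filter fun y => (y, v) ∈ E)) {v}
  have h3 := card_union_le (univ.filter fun y => (y, v) ∉ E ∧ y ≠ v)
      (univ.filter fun y => (y, v) ∈ E)
  rw [← inDegree_eq_card] at h3
  rw [card_univ] at h1
  rw [card_singleton] at h2
  omega

variable (k₁ k₂ M) in
/-- The core edge sets that contain `F`. -/
def coreSetsContaining (F : Finset (V × V)) : Finset (Finset (V × V)) :=
  (coreSets V k₁ k₂ M).filter fun E => F ⊆ E

lemma mem_coreSetsContaining {F E : Finset (V × V)} :
    E ∈ coreSetsContaining k₁ k₂ M F ↔ E ∈ coreSets V k₁ k₂ M ∧ F ⊆ E := by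
  simp [coreSetsContaining]

/-- With surplus at both ends the edge can move to any vacant pair: about N² choices, undone by
naming one of the `M` edges. -/
lemma card_move_edge_le (F : Finset (V × V)) {u v : V} (he : (u, v) ∉ F) :
    #((coreSetsContaining k₁ k₂ M (insert (u, v) F)).filter
        fun E => k₁ < inDegree E v ∧ k₂ < outDegree E u) *
      (Fintype.card V * Fintype.card V - Fintype.card V - M) ≤
    #(coreSetsContaining k₁ k₂ M F) * M := by
  refine card_mul_le_of_exchange _ _ (fun E => (univ : Finset V).offDiag \ E) (fun E => E)
    (fun _ => {(u, v)}) (fun p => {p}) ?_ ?_ ?_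
  · intro E hE p hp
    simp only [mem_filter, mem_coreSetsContaining, insert_subset_iff] at hE
    obtain ⟨⟨hcore, heE, hFE⟩, hin, hout⟩ := hE
    simp only [mem_sdiff, mem_offDiag, mem_univ, true_and] at hp
    have hR : {(u, v)} ⊆ E := by simpa using heE
    have hA : Disjoint E {p} := by simpa using hp.2
    refine ⟨hR, hA, mem_coreSetsContaining.2 ⟨exchange_mem_coreSets hcore hR hA (by simp)
      (by simpa using hp.1) ?_ ?_, subset_exchange hFE (by simpa using he)⟩,
      mem_union_right _ (mem_singleton_self p)⟩
    · intro w
      have := ((mem_coreSets.1 hcore).2.1 w).1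
      rw [card_filter_singleton', card_filter_singleton']
      by_cases h : v = w
      · subst h; simp only [if_true]; omega
      · simp only [h, if_false]; omega
    · intro w
      have := ((mem_coreSets.1 hcore).2.1 w).2
      rw [card_filter_singleton', card_filter_singleton']
      by_cases h : u = w
      · subst h; simp only [if_true]; omega
      · simp only [h, if_false]; omega
  · intro E hE
    have h := le_card_sdiff E (univ : Finset V).offDiag
    rw [offDiag_card, card_univ] at h
    have h3 := (mem_coreSets.1 (mem_coreSetsContaining.1 (mem_filter.1 hE).1).1).2.2
    omega
  · intro E hE
    exact (mem_coreSets.1 (mem_coreSetsContaining.1 hE).1).2.2.le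

/-- The in-degree of `v` is tight, so the head stays and only the tail moves. The image is again
tight at `v`, hence has only `k₁` candidates for the moved edge. -/
lemma card_move_tail_le (F : Finset (V × V)) {u v : V} (he : (u, v) ∉ F) :
    #((coreSetsContaining k₁ k₂ M (insert (u, v) F)).filter
        fun E => inDegree E v = k₁ ∧ k₂ < outDegree E u) *
      (Fintype.card V - k₁ - 1) ≤
    #(coreSetsContaining k₁ k₂ M F) * k₁ := by
  refine (card_mul_le_of_exchange _
    ((coreSetsContaining k₁ k₂ M F).filter fun E => inDegree E v = k₁)
    (fun E => univ.filter fun x => (x, v) ∉ E ∧ x ≠ v) (fun E => univ.filter fun x => (x, v) ∈ E)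
    (fun _ => {(u, v)}) (fun x => {(x, v)}) (n := k₁) ?_ ?_ ?_).trans
    (Nat.mul_le_mul_right _ (card_le_card (filter_subset _ _)))
  · intro E hE p hp
    simp only [mem_filter, mem_coreSetsContaining, insert_subset_iff] at hE
    obtain ⟨⟨hcore, heE, hFE⟩, hin, hout⟩ := hE
    simp only [mem_filter, mem_univ, true_and] at hp
    have hR : {(u, v)} ⊆ E := by simpa using heE
    have hA : Disjoint E {(p, v)} := by simpa using hp.1
    refine ⟨hR, hA, mem_filter.2 ⟨mem_coreSetsContaining.2 ⟨exchange_mem_coreSets hcore hR hA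
      (by simp) (by simpa using hp.2) ?_ ?_, subset_exchange hFE (by simpa using he)⟩, ?_⟩,
      by simp [exchange]⟩
    · intro w
      have := ((mem_coreSets.1 hcore).2.1 w).1
      rw [card_filter_singleton', card_filter_singleton']
      simp only; omega
    · intro w
      have := ((mem_coreSets.1 hcore).2.1 w).2
      rw [card_filter_singleton', card_filter_singleton']
      by_cases h : u = w
      · subst h; simp only [if_true]; omega
      · simp only [h, if_false]; omega
    · have := inDegree_exchange hR hA v
      rw [card_filter_singleton', card_filter_singleton'] at this
      simp only at this; omega
  · intro E hE
    have h := card_non_inNeighbors E v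
    have := (mem_filter.1 hE).2.1
    omega
  · intro E hE
    rw [← inDegree_eq_card]
    exact (mem_filter.1 hE).2.le

/-- The mirror case: the out-degree of `u` is tight, so only the head moves. -/
lemma card_move_head_le (F : Finset (V × V)) {u v : V} (he : (u, v) ∉ F) :
    #((coreSetsContaining k₁ k₂ M (insert (u, v) F)).filter
        fun E => k₁ < inDegree E v ∧ outDegree E u = k₂) *
      (Fintype.card V - k₂ - 1) ≤
    #(coreSetsContaining k₁ k₂ M F) * k₂ := by
  refine (card_mul_le_of_exchange _
    ((coreSetsContaining k₁ k₂ M F).filter fun E => outDegree E u = k₂)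
    (fun E => univ.filter fun x => (u, x) ∉ E ∧ x ≠ u) (fun E => univ.filter fun x => (u, x) ∈ E)
    (fun _ => {(u, v)}) (fun x => {(u, x)}) (n := k₂) ?_ ?_ ?_).trans
    (Nat.mul_le_mul_right _ (card_le_card (filter_subset _ _)))
  · intro E hE p hp
    simp only [mem_filter, mem_coreSetsContaining, insert_subset_iff] at hE
    obtain ⟨⟨hcore, heE, hFE⟩, hin, hout⟩ := hE
    simp only [mem_filter, mem_univ, true_and] at hp
    have hR : {(u, v)} ⊆ E := by simpa using heE
    have hA : Disjoint E {(u, p)} := by simpa using hp.1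
    refine ⟨hR, hA, mem_filter.2 ⟨mem_coreSetsContaining.2 ⟨exchange_mem_coreSets hcore hR hA
      (by simp) (by simpa using hp.2.symm) ?_ ?_, subset_exchange hFE (by simpa using he)⟩, ?_⟩,
      by simp [exchange]⟩
    · intro w
      have := ((mem_coreSets.1 hcore).2.1 w).1
      rw [card_filter_singleton', card_filter_singleton']
      by_cases h : v = w
      · subst h; simp only [if_true]; omega
      · simp only [h, if_false]; omega
    · intro w
      have := ((mem_coreSets.1 hcore).2.1 w).2
      rw [card_filter_singleton', card_filter_singleton']
      simp only; omega
    · have := outDegree_exchange hR hA u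
      rw [card_filter_singleton', card_filter_singleton'] at this
      simp only at this; omega
  · intro E hE
    have h := card_non_outNeighbors E u
    have := (mem_filter.1 hE).2.2
    omega
  · intro E hE
    rw [← outDegree_eq_card]
    exact (mem_filter.1 hE).2.le

/-- The edges of `E` outside `F` whose tail and head can be swapped with those of `(u, v)`. -/
def swappableEdges (F E : Finset (V × V)) (u v : V) : Finset (V × V) :=
  (E \ F).filter fun p => ((u, p.2) ∉ E ∧ p.2 ≠ u) ∧ ((p.1, v) ∉ E ∧ p.1 ≠ v)

/-- The edges of `E` outside `F` with surplus at the tail, whose head can become a head of `u`. -/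
def surplusEdges (k₂ : ℕ) (F E : Finset (V × V)) (u : V) : Finset (V × V) :=
  (E \ F).filter fun p => ((u, p.2) ∉ E ∧ p.2 ≠ u) ∧ k₂ < outDegree E p.1

/-- With both ends tight, a second edge must take part: `(u, v), (z, y)` become `(u, y), (z, v)`,
which preserves all degrees. To undo it, name an in-neighbour `z` of `v` and an out-neighbour `y` of
`u`. -/
lemma card_swap_le (F : Finset (V × V)) {u v : V} (he : (u, v) ∉ F) (m : ℕ) :
    #((coreSetsContaining k₁ k₂ M (insert (u, v) F)).filter
        fun E => (inDegree E v = k₁ ∧ outDegree E u = k₂) ∧ m ≤ #(swappableEdges F E u v)) * m ≤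
    #(coreSetsContaining k₁ k₂ M F) * (k₁ * k₂) := by
  refine (card_mul_le_of_exchange _
    ((coreSetsContaining k₁ k₂ M F).filter fun E => inDegree E v = k₁ ∧ outDegree E u = k₂)
    (fun E => swappableEdges F E u v)
    (fun E => (univ.filter fun x => (x, v) ∈ E) ×ˢ (univ.filter fun y => (u, y) ∈ E))
    (fun p => {(u, v), p}) (fun p => {(u, p.2), (p.1, v)}) (n := k₁ * k₂) ?_ ?_ ?_).trans
    (Nat.mul_le_mul_right _ (card_le_card (filter_subset _ _)))
  · rintro E hE ⟨z, y⟩ hp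
    simp only [mem_filter, mem_coreSetsContaining, insert_subset_iff] at hE
    obtain ⟨⟨hcore, heE, hFE⟩, ⟨hin, hout⟩, -⟩ := hE
    simp only [swappableEdges, mem_filter, mem_sdiff] at hp
    obtain ⟨⟨hzE, hzF⟩, ⟨hy, hyu⟩, hz, hzv⟩ := hp
    have hzu : z ≠ u := by rintro rfl; exact hz heE
    have hne : (u, v) ≠ (z, y) := by simp [hzu.symm]
    have hne' : (u, y) ≠ (z, v) := by simp [hzu.symm]
    have hR : {(u, v), (z, y)} ⊆ E := by simp [insert_subset_iff, heE, hzE]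
    have hA : Disjoint E {(u, y), (z, v)} := by simp [hy, hz]
    refine ⟨hR, hA, mem_filter.2 ⟨mem_coreSetsContaining.2 ⟨exchange_mem_coreSets hcore hR hA
      (by rw [card_pair hne, card_pair hne']) (by simp [hyu.symm, hzv]) ?_ ?_,
      subset_exchange hFE (by simp [he, hzF])⟩, ?_, ?_⟩,
      by simp [exchange]⟩
    · intro w
      have := ((mem_coreSets.1 hcore).2.1 w).1
      rw [card_filter_pair hne, card_filter_pair hne']
      simp only; omega
    · intro w
      have := ((mem_coreSets.1 hcore).2.1 w).2
      rw [card_filter_pair hne, card_filter_pair hne']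
      simp only; omega
    · have := inDegree_exchange hR hA v
      rw [card_filter_pair hne, card_filter_pair hne'] at this
      simp only at this ⊢; omega
    · have := outDegree_exchange hR hA u
      rw [card_filter_pair hne, card_filter_pair hne'] at this
      simp only at this ⊢; omega
  · intro E hE
    exact (mem_filter.1 hE).2.2
  · intro E hE
    obtain ⟨-, h1, h2⟩ := mem_filter.1 hE
    rw [card_product, ← inDegree_eq_card, ← outDegree_eq_card, h1, h2]

/-- The alternative when few edges can be swapped: `(u, v), (z, y)` become `(u, y), (x, v)`, where
`z` has out-degree to spare. The lost tail `z` costs a factor N on the way back, offset by the free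
choice of `x`. -/
lemma card_reroute_le (F : Finset (V × V)) {u v : V} (he : (u, v) ∉ F) (m : ℕ) :
    #((coreSetsContaining k₁ k₂ M (insert (u, v) F)).filter
        fun E => (inDegree E v = k₁ ∧ outDegree E u = k₂) ∧ m ≤ #(surplusEdges k₂ F E u)) *
      (m * (Fintype.card V - k₁ - 1)) ≤
    #(coreSetsContaining k₁ k₂ M F) * (Fintype.card V * k₂ * k₁) := by
  refine (card_mul_le_of_exchange _
    ((coreSetsContaining k₁ k₂ M F).filter fun E => inDegree E v = k₁ ∧ outDegree E u = k₂)
    (fun E => surplusEdges k₂ F E u ×ˢ (univ.filter fun x => (x, v) ∉ E ∧ x ≠ v))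
    (fun E => (univ ×ˢ (univ.filter fun y => (u, y) ∈ E)) ×ˢ (univ.filter fun x => (x, v) ∈ E))
    (fun p => {(u, v), p.1}) (fun p => {(u, p.1.2), (p.2, v)}) (n := Fintype.card V * k₂ * k₁)
    ?_ ?_ ?_).trans
    (Nat.mul_le_mul_right _ (card_le_card (filter_subset _ _)))
  · rintro E hE ⟨⟨z, y⟩, x⟩ hp
    simp only [mem_filter, mem_coreSetsContaining, insert_subset_iff] at hE
    obtain ⟨⟨hcore, heE, hFE⟩, ⟨hin, hout⟩, -⟩ := hE
    simp only [surplusEdges, mem_product, mem_filter, mem_sdiff, mem_univ, true_and] at hp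
    obtain ⟨⟨⟨hzE, hzF⟩, ⟨hy, hyu⟩, hz⟩, hx, hxv⟩ := hp
    have hzu : z ≠ u := by rintro rfl; omega
    have hxu : x ≠ u := by rintro rfl; exact hx heE
    have hne : (u, v) ≠ (z, y) := by simp [hzu.symm]
    have hne' : (u, y) ≠ (x, v) := by simp [hxu.symm]
    have hR : {(u, v), (z, y)} ⊆ E := by simp [insert_subset_iff, heE, hzE]
    have hA : Disjoint E {(u, y), (x, v)} := by simp [hy, hx]
    refine ⟨hR, hA, mem_filter.2 ⟨mem_coreSetsContaining.2 ⟨exchange_mem_coreSets hcore hR hA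
      (by rw [card_pair hne, card_pair hne']) (by simp [hyu.symm, hxv]) ?_ ?_,
      subset_exchange hFE (by simp [he, hzF])⟩, ?_, ?_⟩,
      by simp [exchange]⟩
    · intro w
      have := ((mem_coreSets.1 hcore).2.1 w).1
      rw [card_filter_pair hne, card_filter_pair hne']
      simp only; omega
    · intro w
      have := ((mem_coreSets.1 hcore).2.1 w).2
      rw [card_filter_pair hne, card_filter_pair hne']
      by_cases h : z = w
      · subst h; simp only [if_true]; omega
      · simp only [h, if_false]; omega
    · have := inDegree_exchange hR hA v
      rw [card_filter_pair hne, card_filter_pair hne'] at this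
      simp only at this ⊢; omega
    · have := outDegree_exchange hR hA u
      rw [card_filter_pair hne, card_filter_pair hne'] at this
      simp only [if_true, hzu, hxu, if_false] at this ⊢; omega
  · intro E hE
    rw [card_product]
    have h := card_non_inNeighbors E v
    have := (mem_filter.1 hE).2
    exact Nat.mul_le_mul this.2 (by omega)
  · intro E hE
    obtain ⟨-, h1, h2⟩ := mem_filter.1 hE
    rw [card_product, card_product, ← inDegree_eq_card, ← outDegree_eq_card, h1, h2, card_univ]

/-- When `(u, v)` has no surplus at either end, one of the two exchanges has many instances. -/
lemma card_le_swappable_add_surplus {F E : Finset (V × V)} {u v : V}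
    (hE : E ∈ coreSets V k₁ k₂ M) (hk₁ : 2 ≤ k₁)
    (hin : inDegree E v = k₁) (hout : outDegree E u = k₂) :
    2 * Fintype.card V ≤ #(swappableEdges F E u v) + #(surplusEdges k₂ F E u) + #F +
      (k₁ + 1) * k₂ + 2 * (k₂ + 1) := by
  obtain ⟨-, hdeg, -⟩ := mem_coreSets.1 hE
  set S : Finset V := univ.filter fun y => (u, y) ∉ E ∧ y ≠ u with hS
  set Z : Finset V := (univ.filter fun x => (x, v) ∈ E ∨ x = v).filter
    fun z => outDegree E z ≤ k₂ with hZ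
  have h1 : 2 * #S ≤ #(E.filter fun e => e.2 ∈ S) := by
    rw [card_filter_snd_mem]
    calc 2 * #S = ∑ v ∈ S, 2 := by simp [mul_comm]
      _ ≤ _ := sum_le_sum fun w _ => hk₁.trans (hdeg w).1
  have h2 : Fintype.card V ≤ #S + k₂ + 1 := hout ▸ card_non_outNeighbors E u
  have hZc : #Z ≤ k₁ + 1 := by
    refine (card_le_card (filter_subset _ _)).trans ?_
    rw [filter_or, ← hin, inDegree_eq_card]
    refine (card_union_le _ _).trans ?_
    simp [filter_eq']
  have h3 : #(E.filter fun e => e.1 ∈ Z) ≤ (k₁ + 1) * k₂ := by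
    rw [card_filter_fst_mem]
    calc ∑ z ∈ Z, outDegree E z ≤ ∑ z ∈ Z, k₂ := sum_le_sum fun z hz => (mem_filter.1 hz).2
      _ = #Z * k₂ := by simp
      _ ≤ _ := Nat.mul_le_mul_right _ hZc
  -- An edge outside `F` with head in `S` fails to be swappable only if its tail is `v` or an
  -- in-neighbour of `v`. It is then a surplus edge unless its tail lies in `Z`, which emits a
  -- bounded number of edges.
  have h4 : (E.filter fun e => e.2 ∈ S) ⊆ swappableEdges F E u v ∪ surplusEdges k₂ F E u ∪ F ∪
      (E.filter fun e => e.1 ∈ Z) := by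
    rintro ⟨z, y⟩ he
    simp only [hS, hZ, swappableEdges, surplusEdges, mem_union, mem_filter, mem_univ, true_and,
      mem_sdiff] at he ⊢
    have := le_or_gt (outDegree E z) k₂
    tauto
  have h5 := card_le_card h4
  have h6 := card_union_le (swappableEdges F E u v ∪ surplusEdges k₂ F E u ∪ F)
    (E.filter fun e => e.1 ∈ Z)
  have h7 := card_union_le (swappableEdges F E u v ∪ surplusEdges k₂ F E u) F
  have h8 := card_union_le (swappableEdges F E u v) (surplusEdges k₂ F E u)
  omega

/-- The constant in the bound for the probability that an edge is present. -/
def edgeConst (k₁ k₂ C : ℕ) : ℕ := 2 * C + 2 * k₁ + 2 * k₂ + 6 * (k₁ * k₂)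

/-- A prescribed further edge is present with conditional probability `O(1 / N)`. -/
theorem card_mul_card_coreSetsContaining_insert_le {C : ℕ} (hk₁ : 2 ≤ k₁)
    (hN : 8 * (C + k₁ + k₂ + k₁ * k₂ + 2) ≤ Fintype.card V) (hM : M ≤ C * Fintype.card V)
    {F : Finset (V × V)} (hF : 4 * #F ≤ Fintype.card V) {e : V × V} (he : e ∉ F) :
    Fintype.card V * #(coreSetsContaining k₁ k₂ M (insert e F)) ≤
      edgeConst k₁ k₂ C * #(coreSetsContaining k₁ k₂ M F) := by
  obtain ⟨u, v⟩ := e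
  set N := Fintype.card V
  -- Swappable and surplus edges together number at least 2N minus `#F` and a constant, so one of
  -- the two kinds reaches N/2.
  set m := (N + 1) / 2 with hm
  have hm2 : N ≤ 2 * m := by omega
  have a1 := card_move_edge_le (k₁ := k₁) (k₂ := k₂) (M := M) F he
  have a2 := card_move_tail_le (k₁ := k₁) (k₂ := k₂) (M := M) F he
  have a3 := card_move_head_le (k₁ := k₁) (k₂ := k₂) (M := M) F he
  have a4 := card_swap_le (k₁ := k₁) (k₂ := k₂) (M := M) F he m
  have a5 := card_reroute_le (k₁ := k₁) (k₂ := k₂) (M := M) F he m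
  set T := coreSetsContaining k₁ k₂ M (insert (u, v) F) with hT
  set t := #(coreSetsContaining k₁ k₂ M F)
  set T1 := T.filter fun E => k₁ < inDegree E v ∧ k₂ < outDegree E u
  set T2 := T.filter fun E => inDegree E v = k₁ ∧ k₂ < outDegree E u
  set T3 := T.filter fun E => k₁ < inDegree E v ∧ outDegree E u = k₂
  set T4 := T.filter fun E => (inDegree E v = k₁ ∧ outDegree E u = k₂) ∧
    m ≤ #(swappableEdges F E u v)
  set T5 := T.filter fun E => (inDegree E v = k₁ ∧ outDegree E u = k₂) ∧
    m ≤ #(surplusEdges k₂ F E u)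
  have hcover : T ⊆ T1 ∪ T2 ∪ T3 ∪ T4 ∪ T5 := by
    intro E hE
    have hcore := (mem_coreSetsContaining.1 hE).1
    have hv := ((mem_coreSets.1 hcore).2.1 v).1
    have hu := ((mem_coreSets.1 hcore).2.1 u).2
    have hbig : inDegree E v = k₁ → outDegree E u = k₂ →
        m ≤ #(swappableEdges F E u v) ∨ m ≤ #(surplusEdges k₂ F E u) := by
      intro h1 h2
      have := card_le_swappable_add_surplus (F := F) hcore hk₁ h1 h2
      have h3 : (k₁ + 1) * k₂ = k₁ * k₂ + k₂ := by ring
      omega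
    simp only [T1, T2, T3, T4, T5, mem_union, mem_filter, hE, true_and]
    rcases hv.lt_or_eq with h1 | h1 <;> rcases hu.lt_or_eq with h2 | h2
    · simp [h1, h2]
    · simp [h1, h2.symm]
    · simp [h1.symm, h2]
    · rcases hbig h1.symm h2.symm with h | h
      · simp [h1.symm, h2.symm, h]
      · simp [h1.symm, h2.symm, h]
  have hsum : #T ≤ #T1 + #T2 + #T3 + #T4 + #T5 := by
    have h5 := card_le_card hcover
    have h6 := card_union_le (T1 ∪ T2 ∪ T3 ∪ T4) T5
    have h7 := card_union_le (T1 ∪ T2 ∪ T3) T4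
    have h8 := card_union_le (T1 ∪ T2) T3
    have h9 := card_union_le T1 T2
    omega
  have hN0 : 0 < N := by omega
  have b1 : N * #T1 ≤ 2 * C * t := by
    have h1 : N * N ≤ 2 * (N * N - N - M) := by
      have : 2 * (C + 1) * N ≤ N * N := Nat.mul_le_mul_right _ (by omega)
      have h : 2 * (C + 1) * N = 2 * (C * N) + 2 * N := by ring
      omega
    have h2 : N * (N * #T1) ≤ N * (2 * C * t) := by
      calc N * (N * #T1) = #T1 * (N * N) := by ring
        _ ≤ #T1 * (2 * (N * N - N - M)) := Nat.mul_le_mul_left _ h1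
        _ = 2 * (#T1 * (N * N - N - M)) := by ring
        _ ≤ 2 * (t * M) := Nat.mul_le_mul_left _ a1
        _ ≤ 2 * (t * (C * N)) := by gcongr
        _ = _ := by ring
    exact Nat.le_of_mul_le_mul_left h2 hN0
  have b2 : N * #T2 ≤ 2 * k₁ * t := by
    calc N * #T2 ≤ (2 * (N - k₁ - 1)) * #T2 := Nat.mul_le_mul_right _ (by omega)
      _ = 2 * (#T2 * (N - k₁ - 1)) := by ring
      _ ≤ 2 * (t * k₁) := Nat.mul_le_mul_left _ a2
      _ = _ := by ring
  have b3 : N * #T3 ≤ 2 * k₂ * t := by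
    calc N * #T3 ≤ (2 * (N - k₂ - 1)) * #T3 := Nat.mul_le_mul_right _ (by omega)
      _ = 2 * (#T3 * (N - k₂ - 1)) := by ring
      _ ≤ 2 * (t * k₂) := Nat.mul_le_mul_left _ a3
      _ = _ := by ring
  have b4 : N * #T4 ≤ 2 * (k₁ * k₂) * t := by
    calc N * #T4 ≤ (2 * m) * #T4 := Nat.mul_le_mul_right _ hm2
      _ = 2 * (#T4 * m) := by ring
      _ ≤ 2 * (t * (k₁ * k₂)) := Nat.mul_le_mul_left _ a4
      _ = _ := by ring
  have b5 : N * #T5 ≤ 4 * (k₁ * k₂) * t := by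
    have h2 : N * (N * #T5) ≤ N * (4 * (k₁ * k₂) * t) := by
      calc N * (N * #T5) ≤ (2 * m) * ((2 * (N - k₁ - 1)) * #T5) := by
            gcongr; omega
        _ = 4 * (#T5 * (m * (N - k₁ - 1))) := by ring
        _ ≤ 4 * (t * (N * k₂ * k₁)) := Nat.mul_le_mul_left _ a5
        _ = _ := by ring
    exact Nat.le_of_mul_le_mul_left h2 hN0
  calc N * #T ≤ N * (#T1 + #T2 + #T3 + #T4 + #T5) := Nat.mul_le_mul_left _ hsum
    _ = N * #T1 + N * #T2 + N * #T3 + N * #T4 + N * #T5 := by ring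
    _ ≤ 2 * C * t + 2 * k₁ * t + 2 * k₂ * t + 2 * (k₁ * k₂) * t + 4 * (k₁ * k₂) * t := by gcongr
    _ = edgeConst k₁ k₂ C * t := by rw [edgeConst]; ring

/-- A prescribed set of `f` edges is present with probability `O(1 / N) ^ f`. -/
theorem pow_mul_card_coreSetsContaining_le {C : ℕ} (hk₁ : 2 ≤ k₁)
    (hN : 8 * (C + k₁ + k₂ + k₁ * k₂ + 2) ≤ Fintype.card V) (hM : M ≤ C * Fintype.card V)
    {F : Finset (V × V)} (hF : 4 * #F ≤ Fintype.card V) :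
    Fintype.card V ^ #F * #(coreSetsContaining k₁ k₂ M F) ≤
      edgeConst k₁ k₂ C ^ #F * #(coreSets V k₁ k₂ M) := by
  induction F using Finset.induction_on with
  | empty => simp [coreSetsContaining]
  | insert e F he ih =>
    rw [card_insert_of_notMem he] at hF ⊢
    have h1 := card_mul_card_coreSetsContaining_insert_le hk₁ hN hM (F := F) (by omega) he
    have h2 := ih (by omega)
    calc Fintype.card V ^ (#F + 1) * #(coreSetsContaining k₁ k₂ M (insert e F))
        = Fintype.card V ^ #F *
          (Fintype.card V * #(coreSetsContaining k₁ k₂ M (insert e F))) := by ring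
      _ ≤ Fintype.card V ^ #F * (edgeConst k₁ k₂ C * #(coreSetsContaining k₁ k₂ M F)) :=
          Nat.mul_le_mul_left _ h1
      _ = edgeConst k₁ k₂ C * (Fintype.card V ^ #F * #(coreSetsContaining k₁ k₂ M F)) := by ring
      _ ≤ edgeConst k₁ k₂ C * (edgeConst k₁ k₂ C ^ #F * #(coreSets V k₁ k₂ M)) :=
          Nat.mul_le_mul_left _ h2
      _ = _ := by ring

end EdgeBound

/-! ### Union bounds for small traps, poor expansion and large degrees -/

section RareEvents

variable {V : Type*} [DecidableEq V] [Fintype V] {k₁ k₂ M : ℕ}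

/-- Every edge of `E` with tail in `X` has its head in `Y`. -/
def Confined (E : Finset (V × V)) (X Y : Finset V) : Prop := ∀ e ∈ E, e.1 ∈ X → e.2 ∈ Y

instance (E : Finset (V × V)) (X Y : Finset V) : Decidable (Confined E X Y) :=
  inferInstanceAs (Decidable (∀ e ∈ E, e.1 ∈ X → e.2 ∈ Y))

/-- Each vertex of `X` has `k₂` out-neighbours in `Y`. Selecting them prescribes `k₂ * #X` edges,
and there are at most `#Y ^ (k₂ * #X)` selections. -/
theorem pow_mul_card_confined_le {C : ℕ} (hk₁ : 2 ≤ k₁)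
    (hN : 8 * (C + k₁ + k₂ + k₁ * k₂ + 2) ≤ Fintype.card V) (hM : M ≤ C * Fintype.card V)
    {X Y : Finset V} (hX : 4 * (k₂ * #X) ≤ Fintype.card V) :
    Fintype.card V ^ (k₂ * #X) * #((coreSets V k₁ k₂ M).filter fun E => Confined E X Y) ≤
      (#Y * edgeConst k₁ k₂ C) ^ (k₂ * #X) * #(coreSets V k₁ k₂ M) := by
  -- A selection `f` is forced to be empty outside `X`, so that `G f` has exactly `k₂ * #X` edges.
  set t : V → Finset (Finset V) := fun v => if v ∈ X then powersetCard k₂ Y else {∅} with ht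
  set G : (V → Finset V) → Finset (V × V) := fun f => univ.filter fun e => e.2 ∈ f e.1 with hG
  have hGcard : ∀ f ∈ Fintype.piFinset t, #(G f) = k₂ * #X := by
    intro f hf
    rw [Fintype.mem_piFinset] at hf
    have h1 : #(G f) = ∑ v, #(f v) := by
      rw [card_eq_sum_card_fiberwise (f := Prod.fst) (t := univ) (fun _ _ => by simp)]
      refine sum_congr rfl fun v _ => ?_
      refine (card_bij (fun y _ => (v, y)) ?_ ?_ ?_).symm
      · intro y hy; simpa [hG] using hy
      · intro a _ b _ h; simpa using h
      · rintro ⟨a, b⟩ h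
        simp only [hG, mem_filter, mem_univ, true_and] at h
        obtain ⟨h, rfl⟩ := h
        exact ⟨b, h, rfl⟩
    have h2 : ∀ v, #(f v) = if v ∈ X then k₂ else 0 := by
      intro v
      have := hf v
      simp only [ht] at this
      split_ifs at this ⊢ with h
      · exact (mem_powersetCard.1 this).2
      · simpa using this
    rw [h1, sum_congr rfl fun v _ => h2 v, sum_ite_mem, univ_inter]
    simp [mul_comm]
  have hcover : (coreSets V k₁ k₂ M).filter (fun E => Confined E X Y) ⊆
      (Fintype.piFinset t).biUnion fun f => coreSetsContaining k₁ k₂ M (G f) := by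
    intro E hE
    obtain ⟨hcore, hconf⟩ := mem_filter.1 hE
    have hex : ∀ v, ∃ S ∈ t v, ∀ y ∈ S, (v, y) ∈ E := by
      intro v
      by_cases hv : v ∈ X
      · have h1 := ((mem_coreSets.1 hcore).2.1 v).2
        rw [outDegree_eq_card] at h1
        obtain ⟨S, hS, hSc⟩ := exists_subset_card_eq h1
        refine ⟨S, ?_, fun y hy => (mem_filter.1 (hS hy)).2⟩
        simp only [ht, hv, if_true, mem_powersetCard]
        exact ⟨fun y hy => hconf _ (mem_filter.1 (hS hy)).2 hv, hSc⟩
      · exact ⟨∅, by simp [ht, hv], by simp⟩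
    choose f hf1 hf2 using hex
    refine mem_biUnion.2 ⟨f, Fintype.mem_piFinset.2 hf1, mem_coreSetsContaining.2 ⟨hcore, ?_⟩⟩
    rintro ⟨a, b⟩ h
    exact hf2 a b (by simpa [hG] using h)
  have hpi : #(Fintype.piFinset t) ≤ #Y ^ (k₂ * #X) := by
    rw [Fintype.card_piFinset]
    calc ∏ v, #(t v) ≤ ∏ v, (if v ∈ X then #Y ^ k₂ else 1) := by
          refine prod_le_prod' fun v _ => ?_
          simp only [ht]
          split_ifs with h
          · rw [card_powersetCard]; exact Nat.choose_le_pow _ _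
          · simp
      _ = _ := by rw [prod_ite_mem, univ_inter, prod_const, pow_mul]
  calc Fintype.card V ^ (k₂ * #X) * #((coreSets V k₁ k₂ M).filter fun E => Confined E X Y)
      ≤ Fintype.card V ^ (k₂ * #X) *
        ∑ f ∈ Fintype.piFinset t, #(coreSetsContaining k₁ k₂ M (G f)) :=
        Nat.mul_le_mul_left _ ((card_le_card hcover).trans card_biUnion_le)
    _ = ∑ f ∈ Fintype.piFinset t,
        Fintype.card V ^ (k₂ * #X) * #(coreSetsContaining k₁ k₂ M (G f)) := by rw [mul_sum]
    _ ≤ ∑ f ∈ Fintype.piFinset t, edgeConst k₁ k₂ C ^ (k₂ * #X) * #(coreSets V k₁ k₂ M) := by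
        refine sum_le_sum fun f hf => ?_
        have h := pow_mul_card_coreSetsContaining_le (F := G f) hk₁ hN hM
          (by rw [hGcard f hf]; exact hX)
        rwa [hGcard f hf] at h
    _ = #(Fintype.piFinset t) * (edgeConst k₁ k₂ C ^ (k₂ * #X) * #(coreSets V k₁ k₂ M)) := by
        simp
    _ ≤ #Y ^ (k₂ * #X) * (edgeConst k₁ k₂ C ^ (k₂ * #X) * #(coreSets V k₁ k₂ M)) :=
        Nat.mul_le_mul_right _ hpi
    _ = _ := by rw [mul_pow]; ring

lemma card_confined_le {C : ℕ} (hk₁ : 2 ≤ k₁)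
    (hN : 8 * (C + k₁ + k₂ + k₁ * k₂ + 2) ≤ Fintype.card V) (hM : M ≤ C * Fintype.card V)
    {X Y : Finset V} (hX : 4 * (k₂ * #X) ≤ Fintype.card V) :
    (#((coreSets V k₁ k₂ M).filter fun E => Confined E X Y) : ℝ) ≤
      (#Y * edgeConst k₁ k₂ C / Fintype.card V : ℝ) ^ (k₂ * #X) * #(coreSets V k₁ k₂ M) := by
  have h := pow_mul_card_confined_le hk₁ hN hM hX (Y := Y)
  have hN0 : (0 : ℝ) < Fintype.card V := by
    have : 0 < Fintype.card V := by omega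
    exact_mod_cast this
  have h' : (Fintype.card V : ℝ) ^ (k₂ * #X) *
      #((coreSets V k₁ k₂ M).filter fun E => Confined E X Y) ≤
      (#Y * edgeConst k₁ k₂ C) ^ (k₂ * #X) * #(coreSets V k₁ k₂ M) := by exact_mod_cast h
  rw [div_pow, div_mul_eq_mul_div, le_div_iff₀ (by positivity)]
  linarith

/-- `x ^ x / x!` is a term of the exponential series at `x`, and e < 3. -/
lemma choose_le_three_mul_div_pow (N : ℕ) {x : ℕ} (hx : 0 < x) :
    (N.choose x : ℝ) ≤ (3 * N / x) ^ x := by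
  have hx' : (0 : ℝ) < x := by exact_mod_cast hx
  have h1 : (x : ℝ) ^ x / x.factorial ≤ 3 ^ x := by
    refine (Real.pow_div_factorial_le_exp x hx'.le x).trans ?_
    rw [← mul_one (x : ℝ), Real.exp_nat_mul]
    gcongr
    exact (Real.exp_one_lt_d9.trans (by norm_num)).le
  calc (N.choose x : ℝ) ≤ (N : ℝ) ^ x / x.factorial := Nat.choose_le_pow_div _ _
    _ = (N / x : ℝ) ^ x * ((x : ℝ) ^ x / x.factorial) := by
        rw [div_pow]; field_simp
    _ ≤ (N / x : ℝ) ^ x * 3 ^ x := by gcongr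
    _ = _ := by rw [← mul_pow]; congr 1; ring

lemma sq_le_four_mul_two_pow (x : ℕ) : x ^ 2 ≤ 4 * 2 ^ x := by
  induction x with
  | zero => simp
  | succ n ih =>
    rcases Nat.lt_or_ge n 3 with h | h
    · interval_cases n <;> norm_num
    · have : (n + 1) ^ 2 ≤ 2 * n ^ 2 := by nlinarith
      rw [pow_succ 2 n]; omega

/-- The summand in the union bound over sets of `x` vertices. -/
lemma trap_term_le {N x s a m : ℕ} (ha : 1 ≤ a) (hm : 1 ≤ m) (hx : 2 ≤ x)
    (hxN : 4 * (3 * ((s + 1) * a) ^ 2 * x) ≤ N) :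
    (N.choose x : ℝ) * ((x + s) * a / N : ℝ) ^ ((m + 1) * x) ≤
      (64 * (3 * ((s + 1) * a : ℝ) ^ 2) ^ 2 / N ^ 2) ^ m * (1 / 2) ^ x := by
  have hx0 : (0 : ℝ) < x := by exact_mod_cast (by omega : 0 < x)
  have hx1 : (1 : ℝ) ≤ x := by exact_mod_cast (by omega : 1 ≤ x)
  have hN1 : 1 ≤ N := by
    have : 0 < 4 * (3 * ((s + 1) * a) ^ 2 * x) := by positivity
    omega
  have hN0 : (0 : ℝ) < N := by exact_mod_cast hN1
  -- The constant `b` absorbs the exits, since `x + s ≤ (s + 1) * x`.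
  obtain ⟨b, hb⟩ : ∃ b : ℝ, b = (s + 1) * a := ⟨_, rfl⟩
  have ha' : (1 : ℝ) ≤ a := by exact_mod_cast ha
  have hb1 : 1 ≤ b := by
    rw [hb]
    have : (0 : ℝ) ≤ s := by positivity
    nlinarith
  have hxN' : 3 * b ^ 2 * x / N ≤ 1 / 4 := by
    rw [div_le_iff₀ hN0, hb]
    have : (4 * (3 * ((s + 1) * a) ^ 2 * x) : ℝ) ≤ N := by exact_mod_cast hxN
    linarith
  rw [← hb]
  have e1 : ((x + s) * a / N : ℝ) ≤ b * x / N := by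
    refine div_le_div_of_nonneg_right ?_ hN0.le
    rw [hb]
    have : (0 : ℝ) ≤ s * (x - 1) := mul_nonneg (by positivity) (by linarith)
    have : ((x + s : ℝ)) ≤ (s + 1) * x := by linarith
    calc (x + s : ℝ) * a ≤ (s + 1) * x * a := by gcongr
      _ = _ := by ring
  -- One of the `m + 1` factors cancels the N/x of the binomial coefficient.
  have e2 : (3 * N / x : ℝ) * (b * x / N) ^ (m + 1) ≤ (3 * b ^ 2 * x / N) ^ m := by
    calc (3 * N / x : ℝ) * (b * x / N) ^ (m + 1) = (3 * b) * (b * x / N) ^ m := by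
          rw [pow_succ]; field_simp
      _ ≤ (3 * b) ^ m * (b * x / N) ^ m := by
          gcongr
          exact le_self_pow₀ (by linarith) (by omega)
      _ = _ := by rw [← mul_pow]; congr 1; ring
  -- Two of the `x` factors supply N^(-2). Each other factor is at most 1/4 = 1/2 · 1/2: one half
  -- absorbs `x ^ 2`, the other makes the sum over `x` converge.
  have e3 : (3 * b ^ 2 * x / N) ^ x ≤ 64 * (3 * b ^ 2) ^ 2 / N ^ 2 * (1 / 2) ^ x := by
    obtain ⟨y, rfl⟩ : ∃ y, x = y + 2 := ⟨x - 2, by omega⟩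
    have h4 : ((y + 2 : ℕ) : ℝ) ^ 2 ≤ 4 * 2 ^ (y + 2) := by
      exact_mod_cast sq_le_four_mul_two_pow (y + 2)
    calc (3 * b ^ 2 * (y + 2 : ℕ) / N) ^ (y + 2)
        = (3 * b ^ 2 * (y + 2 : ℕ) / N) ^ y * (3 * b ^ 2 * (y + 2 : ℕ) / N) ^ 2 := pow_add _ _ _
      _ ≤ (1 / 4) ^ y * (3 * b ^ 2 * (y + 2 : ℕ) / N) ^ 2 := by gcongr
      _ = (1 / 4) ^ y * (3 * b ^ 2) ^ 2 / N ^ 2 * ((y + 2 : ℕ) : ℝ) ^ 2 := by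
          rw [div_pow, mul_pow]; ring
      _ ≤ (1 / 4) ^ y * (3 * b ^ 2) ^ 2 / N ^ 2 * (4 * 2 ^ (y + 2)) := by gcongr
      _ = 64 * (3 * b ^ 2) ^ 2 / N ^ 2 * (1 / 2) ^ (y + 2) := by
          have : (1 / 4 : ℝ) ^ y = (1 / 2) ^ y * (1 / 2) ^ y := by rw [← mul_pow]; norm_num
          have h2 : (1 / 2 : ℝ) ^ y * 2 ^ y = 1 := by rw [← mul_pow]; norm_num
          rw [this, pow_add, pow_add]
          linear_combination (16 * (1 / 2 : ℝ) ^ y * (3 * b ^ 2) ^ 2 / N ^ 2) * h2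
  calc (N.choose x : ℝ) * ((x + s) * a / N : ℝ) ^ ((m + 1) * x)
      ≤ (3 * N / x) ^ x * (b * x / N) ^ ((m + 1) * x) := by
        gcongr
        exact choose_le_three_mul_div_pow N (by omega)
    _ = ((3 * N / x : ℝ) * (b * x / N) ^ (m + 1)) ^ x := by rw [mul_pow, ← pow_mul]
    _ ≤ ((3 * b ^ 2 * x / N) ^ m) ^ x := by gcongr
    _ = ((3 * b ^ 2 * x / N) ^ x) ^ m := pow_right_comm _ _ _
    _ ≤ (64 * (3 * b ^ 2) ^ 2 / N ^ 2 * (1 / 2) ^ x) ^ m := by gcongr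
    _ = (64 * (3 * b ^ 2) ^ 2 / N ^ 2) ^ m * ((1 / 2) ^ x) ^ m := mul_pow _ _ _
    _ ≤ (64 * (3 * b ^ 2) ^ 2 / N ^ 2) ^ m * (1 / 2) ^ x := by
        gcongr
        exact pow_le_of_le_one (by positivity) (pow_le_one₀ (by norm_num) (by norm_num)) (by omega)

/-- Some set of between `2` and `L` vertices can be left only through `s` fixed vertices. -/
def HasTrap (s L : ℕ) (E : Finset (V × V)) : Prop :=
  ∃ X T : Finset V, 2 ≤ #X ∧ #X ≤ L ∧ #T = s ∧ Confined E X (X ∪ T)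

/-- Some set of `2 * w` vertices has all its edges into itself and `w` further vertices. -/
def ExpandsPoorly (w : ℕ) (E : Finset (V × V)) : Prop :=
  ∃ X W : Finset V, #X = 2 * w ∧ #W = w ∧ Confined E X (X ∪ W)

-- Union bound over `X` and `T`; the geometric decay in `#X` leaves the order of the case `#X = 2`.
-- The same bound for singletons would only be of order N^(s + 1 - k₂), which is why traps start at
-- two vertices.
open scoped Classical in
theorem card_hasTrap_le {C s L : ℕ} (hk₁ : 2 ≤ k₁) (hk₂ : 2 ≤ k₂)
    (hN : 8 * (C + k₁ + k₂ + k₁ * k₂ + 2) ≤ Fintype.card V) (hM : M ≤ C * Fintype.card V)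
    (hL : 4 * (k₂ * L) ≤ Fintype.card V)
    (hL' : 4 * (3 * ((s + 1) * edgeConst k₁ k₂ C) ^ 2 * L) ≤ Fintype.card V) :
    (#((coreSets V k₁ k₂ M).filter (HasTrap s L)) : ℝ) ≤
      2 * (64 * (3 * ((s + 1) * edgeConst k₁ k₂ C : ℝ) ^ 2) ^ 2) ^ (k₂ - 1) *
        (Fintype.card V : ℝ) ^ s / (Fintype.card V : ℝ) ^ (2 * (k₂ - 1)) *
        #(coreSets V k₁ k₂ M) := by
  obtain ⟨m, rfl⟩ : ∃ m, k₂ = m + 1 := ⟨k₂ - 1, by omega⟩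
  set N := Fintype.card V with hNdef
  set a := edgeConst k₁ (m + 1) C with ha
  have ha1 : 1 ≤ a := by rw [ha, edgeConst]; omega
  have hcover : (coreSets V k₁ (m + 1) M).filter (HasTrap s L) ⊆
      (Icc 2 L).biUnion fun x => (powersetCard x univ).biUnion fun X =>
        (powersetCard s univ).biUnion fun T =>
          (coreSets V k₁ (m + 1) M).filter fun E => Confined E X (X ∪ T) := by
    intro E hE
    obtain ⟨hE, X, T, h1, h2, h3, h4⟩ := mem_filter.1 hE
    simp only [mem_biUnion, mem_powersetCard, mem_filter]
    exact ⟨#X, mem_Icc.2 ⟨h1, h2⟩, X, ⟨subset_univ _, rfl⟩, T, ⟨subset_univ _, h3⟩, hE, h4⟩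
  have hnat : #((coreSets V k₁ (m + 1) M).filter (HasTrap s L)) ≤
      ∑ x ∈ Icc 2 L, ∑ X ∈ powersetCard x (univ : Finset V), ∑ T ∈ powersetCard s univ,
        #((coreSets V k₁ (m + 1) M).filter fun E => Confined E X (X ∪ T)) :=
    (card_le_card hcover).trans <| card_biUnion_le.trans <| sum_le_sum fun x _ =>
      card_biUnion_le.trans <| sum_le_sum fun X _ => card_biUnion_le
  have hcast : (#((coreSets V k₁ (m + 1) M).filter (HasTrap s L)) : ℝ) ≤
      ∑ x ∈ Icc 2 L, ∑ X ∈ powersetCard x (univ : Finset V), ∑ T ∈ powersetCard s univ,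
        (#((coreSets V k₁ (m + 1) M).filter fun E => Confined E X (X ∪ T)) : ℝ) := by
    exact_mod_cast hnat
  refine hcast.trans ?_
  have hterm : ∀ x ∈ Icc 2 L, ∀ X ∈ powersetCard x (univ : Finset V),
      ∀ T ∈ powersetCard s (univ : Finset V),
      (#((coreSets V k₁ (m + 1) M).filter fun E => Confined E X (X ∪ T)) : ℝ) ≤
        ((x + s) * a / N : ℝ) ^ ((m + 1) * x) * #(coreSets V k₁ (m + 1) M) := by
    intro x hx X hX T hT
    have hXc := (mem_powersetCard.1 hX).2
    have hTc := (mem_powersetCard.1 hT).2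
    have hxL := (mem_Icc.1 hx).2
    have h := card_confined_le (X := X) (Y := X ∪ T) hk₁ hN hM (by
      rw [hXc]
      have : (m + 1) * x ≤ (m + 1) * L := Nat.mul_le_mul_left _ hxL
      omega)
    rw [hXc] at h
    refine h.trans ?_
    have : (#(X ∪ T) : ℝ) ≤ x + s := by
      have := card_union_le X T
      rw [hXc, hTc] at this
      exact_mod_cast this
    gcongr
  calc ∑ x ∈ Icc 2 L, ∑ X ∈ powersetCard x (univ : Finset V), ∑ T ∈ powersetCard s univ,
        (#((coreSets V k₁ (m + 1) M).filter fun E => Confined E X (X ∪ T)) : ℝ)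
      ≤ ∑ x ∈ Icc 2 L, ∑ X ∈ powersetCard x (univ : Finset V),
          ∑ T ∈ powersetCard s (univ : Finset V),
          ((x + s) * a / N : ℝ) ^ ((m + 1) * x) * #(coreSets V k₁ (m + 1) M) :=
        sum_le_sum fun x hx => sum_le_sum fun X hX => sum_le_sum fun T hT => hterm x hx X hX T hT
    _ = ∑ x ∈ Icc 2 L, (N.choose s : ℝ) * ((N.choose x : ℝ) *
          ((x + s) * a / N : ℝ) ^ ((m + 1) * x)) * #(coreSets V k₁ (m + 1) M) := by
        refine sum_congr rfl fun x _ => ?_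
        simp only [sum_const, card_powersetCard, card_univ, nsmul_eq_mul]
        ring
    _ ≤ ∑ x ∈ Icc 2 L, (N : ℝ) ^ s * ((64 * (3 * ((s + 1) * a : ℝ) ^ 2) ^ 2 / N ^ 2) ^ m *
          (1 / 2) ^ x) * #(coreSets V k₁ (m + 1) M) := by
        refine sum_le_sum fun x hx => ?_
        obtain ⟨hx2, hxL⟩ := mem_Icc.1 hx
        have h1 : (N.choose s : ℝ) ≤ (N : ℝ) ^ s := by exact_mod_cast Nat.choose_le_pow _ _
        have h2 := trap_term_le (N := N) (x := x) (s := s) (m := m) ha1 (by omega) hx2 (by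
          refine le_trans ?_ hL'
          gcongr)
        gcongr
    _ = (N : ℝ) ^ s * (64 * (3 * ((s + 1) * a : ℝ) ^ 2) ^ 2 / N ^ 2) ^ m *
          #(coreSets V k₁ (m + 1) M) * ∑ x ∈ Icc 2 L, (1 / (2 : ℝ)) ^ x := by
        rw [mul_sum]
        refine sum_congr rfl fun x _ => ?_
        ring
    _ ≤ (N : ℝ) ^ s * (64 * (3 * ((s + 1) * a : ℝ) ^ 2) ^ 2 / N ^ 2) ^ m *
          #(coreSets V k₁ (m + 1) M) * 2 := by
        gcongr
        refine le_trans ?_ (sum_geometric_two_le (L + 1))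
        refine sum_le_sum_of_subset_of_nonneg ?_ fun _ _ _ => by positivity
        intro x hx
        have := (mem_Icc.1 hx).2
        exact mem_range.2 (by omega)
    _ = _ := by
        rw [div_pow, ← pow_mul]
        simp only [Nat.add_sub_cancel]
        ring

-- The pairs `X`, `W` number at most O(N/w)^(3w), while at least `4 * w` prescribed edges, as `k₂ ≥
-- 2`, contribute O(w/N) each. A factor O(w/N)^w is left over.
open scoped Classical in
theorem card_expandsPoorly_le {C w : ℕ} (hk₁ : 2 ≤ k₁) (hk₂ : 2 ≤ k₂)
    (hN : 8 * (C + k₁ + k₂ + k₁ * k₂ + 2) ≤ Fintype.card V) (hM : M ≤ C * Fintype.card V)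
    (hw : 8 * (k₂ * w) ≤ Fintype.card V)
    (hw' : 1094 * (edgeConst k₁ k₂ C ^ 4 * w) ≤ Fintype.card V) :
    (#((coreSets V k₁ k₂ M).filter (ExpandsPoorly w)) : ℝ) ≤
      (1 / 2) ^ w * #(coreSets V k₁ k₂ M) := by
  rcases Nat.eq_zero_or_pos w with rfl | hw0
  · simp only [pow_zero, one_mul]
    exact_mod_cast card_le_card (filter_subset _ _)
  set N := Fintype.card V with hNdef
  set a := edgeConst k₁ k₂ C with ha
  have ha1 : 1 ≤ a := by rw [ha, edgeConst]; omega
  have hN0 : (0 : ℝ) < N := by exact_mod_cast (by omega : 0 < N)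
  have hw0' : (0 : ℝ) < w := by exact_mod_cast hw0
  have ha1' : (1 : ℝ) ≤ a := by exact_mod_cast ha1
  have hw'' : 1094 * ((a : ℝ) ^ 4 * w) ≤ N := by exact_mod_cast hw'
  have hcover : (coreSets V k₁ k₂ M).filter (ExpandsPoorly w) ⊆
      (powersetCard (2 * w) univ).biUnion fun X => (powersetCard w univ).biUnion fun W =>
          (coreSets V k₁ k₂ M).filter fun E => Confined E X (X ∪ W) := by
    intro E hE
    obtain ⟨hE, X, T, h1, h2, h3⟩ := mem_filter.1 hE
    simp only [mem_biUnion, mem_powersetCard, mem_filter]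
    exact ⟨X, ⟨subset_univ _, h1⟩, T, ⟨subset_univ _, h2⟩, hE, h3⟩
  have hnat : #((coreSets V k₁ k₂ M).filter (ExpandsPoorly w)) ≤
      ∑ X ∈ powersetCard (2 * w) (univ : Finset V), ∑ W ∈ powersetCard w univ,
        #((coreSets V k₁ k₂ M).filter fun E => Confined E X (X ∪ W)) :=
    (card_le_card hcover).trans <| card_biUnion_le.trans <| sum_le_sum fun X _ => card_biUnion_le
  have hcast : (#((coreSets V k₁ k₂ M).filter (ExpandsPoorly w)) : ℝ) ≤
      ∑ X ∈ powersetCard (2 * w) (univ : Finset V), ∑ W ∈ powersetCard w univ,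
        (#((coreSets V k₁ k₂ M).filter fun E => Confined E X (X ∪ W)) : ℝ) := by
    exact_mod_cast hnat
  refine hcast.trans ?_
  have hterm : ∀ X ∈ powersetCard (2 * w) (univ : Finset V), ∀ W ∈ powersetCard w univ,
        (#((coreSets V k₁ k₂ M).filter fun E => Confined E X (X ∪ W)) : ℝ) ≤
        (3 * w * a / N : ℝ) ^ (4 * w) * #(coreSets V k₁ k₂ M) := by
    intro X hX T hT
    have hXc := (mem_powersetCard.1 hX).2
    have hTc := (mem_powersetCard.1 hT).2
    have h := card_confined_le (X := X) (Y := X ∪ T) hk₁ hN hM (by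
      rw [hXc]
      have : k₂ * (2 * w) = 2 * (k₂ * w) := by ring
      omega)
    rw [hXc] at h
    refine h.trans ?_
    have : (#(X ∪ T) : ℝ) ≤ 3 * w := by
      have := card_union_le X T
      rw [hXc, hTc] at this
      have : #(X ∪ T) ≤ 3 * w := by omega
      exact_mod_cast this
    have hle1 : (3 * w * a / N : ℝ) ≤ 1 := by
      rw [div_le_one hN0]
      have h5 : (a : ℝ) ≤ a ^ 4 := le_self_pow₀ ha1' (by norm_num)
      have h6 : (a : ℝ) * w ≤ a ^ 4 * w := by gcongr
      have h7 : (0 : ℝ) ≤ a * w := by positivity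
      nlinarith
    calc (#(X ∪ T) * a / N : ℝ) ^ (k₂ * (2 * w)) * #(coreSets V k₁ k₂ M)
        ≤ (3 * w * a / N : ℝ) ^ (k₂ * (2 * w)) * #(coreSets V k₁ k₂ M) := by gcongr
      _ ≤ (3 * w * a / N : ℝ) ^ (4 * w) * #(coreSets V k₁ k₂ M) := by
          gcongr ?_ * _
          refine pow_le_pow_of_le_one (by positivity) hle1 ?_
          nlinarith
  calc ∑ X ∈ powersetCard (2 * w) (univ : Finset V), ∑ W ∈ powersetCard w univ,
        (#((coreSets V k₁ k₂ M).filter fun E => Confined E X (X ∪ W)) : ℝ)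
      ≤ ∑ X ∈ powersetCard (2 * w) (univ : Finset V), ∑ W ∈ powersetCard w (univ : Finset V),
        (3 * w * a / N : ℝ) ^ (4 * w) * #(coreSets V k₁ k₂ M) :=
        sum_le_sum fun X hX => sum_le_sum fun T hT => hterm X hX T hT
    _ = (N.choose (2 * w) : ℝ) * (N.choose w : ℝ) * (3 * w * a / N : ℝ) ^ (4 * w) *
          #(coreSets V k₁ k₂ M) := by
        simp only [sum_const, card_powersetCard, card_univ, nsmul_eq_mul]
        ring
    _ ≤ (3 * N / (2 * w : ℕ) : ℝ) ^ (2 * w) * (3 * N / w : ℝ) ^ w *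
          (3 * w * a / N : ℝ) ^ (4 * w) * #(coreSets V k₁ k₂ M) := by
        gcongr
        · exact choose_le_three_mul_div_pow N (by omega)
        · exact choose_le_three_mul_div_pow N hw0
    -- 2187/4 = (3/2)² · 3 · 3⁴, from the two binomials and the edge factor; 1094 in the hypothesis
    -- is twice this, rounded up.
    _ = (2187 / 4 * a ^ 4 * w / N : ℝ) ^ w * #(coreSets V k₁ k₂ M) := by
        rw [pow_mul, pow_mul, ← mul_pow, ← mul_pow]
        congr 2
        push_cast
        field_simp
        norm_num
    _ ≤ _ := by
        gcongr ?_ ^ _ * _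
        rw [div_le_iff₀ hN0]
        nlinarith [show (0 : ℝ) ≤ a ^ 4 * w by positivity]

/-- Some vertex has out-degree at least `d`. -/
def HasLargeOutDegree (d : ℕ) (E : Finset (V × V)) : Prop := ∃ u, d ≤ outDegree E u

-- For each vertex, the union over `d` prescribed out-neighbours costs at most (3a/d)^d, which is at
-- most 2^(-d) once `d ≥ 6a`.
open scoped Classical in
theorem card_hasLargeOutDegree_le {C d : ℕ} (hk₁ : 2 ≤ k₁)
    (hN : 8 * (C + k₁ + k₂ + k₁ * k₂ + 2) ≤ Fintype.card V) (hM : M ≤ C * Fintype.card V)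
    (hd : 4 * d ≤ Fintype.card V) (hd' : 6 * edgeConst k₁ k₂ C ≤ d) :
    (#((coreSets V k₁ k₂ M).filter (HasLargeOutDegree d)) : ℝ) ≤
      Fintype.card V * (1 / 2) ^ d * #(coreSets V k₁ k₂ M) := by
  set N := Fintype.card V with hNdef
  set a := edgeConst k₁ k₂ C with ha
  have hN0 : (0 : ℝ) < N := by exact_mod_cast (by omega : 0 < N)
  have ha1 : 1 ≤ a := by rw [ha, edgeConst]; omega
  have hd0 : 0 < d := by omega
  have hd0' : (0 : ℝ) < d := by exact_mod_cast hd0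
  set G : V → Finset V → Finset (V × V) := fun u S => S.map ⟨fun y => (u, y), fun a b h => by
    simpa using h⟩ with hG
  have hcover : ((coreSets V k₁ k₂ M).filter (HasLargeOutDegree d)) ⊆
      (univ : Finset V).biUnion fun u => (powersetCard d univ).biUnion fun S =>
        coreSetsContaining k₁ k₂ M (G u S) := by
    intro E hE
    obtain ⟨hE, u, hu⟩ := mem_filter.1 hE
    rw [outDegree_eq_card] at hu
    obtain ⟨S, hS, hSc⟩ := exists_subset_card_eq hu
    simp only [mem_biUnion, mem_powersetCard, mem_univ, true_and, mem_coreSetsContaining]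
    refine ⟨u, S, ⟨subset_univ _, hSc⟩, hE, ?_⟩
    intro e he
    obtain ⟨y, hy, rfl⟩ := mem_map.1 he
    exact (mem_filter.1 (hS hy)).2
  have hnat := (card_le_card hcover).trans <| card_biUnion_le.trans <|
    sum_le_sum fun u _ => card_biUnion_le
  have hcast : (#((coreSets V k₁ k₂ M).filter (HasLargeOutDegree d)) : ℝ) ≤
      ∑ u : V, ∑ S ∈ powersetCard d (univ : Finset V),
        (#(coreSetsContaining k₁ k₂ M (G u S)) : ℝ) := by exact_mod_cast hnat
  refine hcast.trans ?_
  calc ∑ u : V, ∑ S ∈ powersetCard d (univ : Finset V),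
        (#(coreSetsContaining k₁ k₂ M (G u S)) : ℝ)
      ≤ ∑ u : V, ∑ S ∈ powersetCard d (univ : Finset V),
          (a / N : ℝ) ^ d * #(coreSets V k₁ k₂ M) := by
        refine sum_le_sum fun u _ => sum_le_sum fun S hS => ?_
        have hSc : #(G u S) = d := by
          rw [hG, card_map]; exact (mem_powersetCard.1 hS).2
        have h := pow_mul_card_coreSetsContaining_le (F := G u S) hk₁ hN hM (by rwa [hSc])
        rw [hSc] at h
        have h' : (N : ℝ) ^ d * #(coreSetsContaining k₁ k₂ M (G u S)) ≤
          (a : ℝ) ^ d * #(coreSets V k₁ k₂ M) := by exact_mod_cast h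
        rw [div_pow, div_mul_eq_mul_div, le_div_iff₀ (by positivity)]
        linarith
    _ = N * ((N.choose d : ℝ) * (a / N : ℝ) ^ d) * #(coreSets V k₁ k₂ M) := by
        simp only [sum_const, card_powersetCard, card_univ, nsmul_eq_mul]
        ring
    _ ≤ N * ((3 * N / d : ℝ) ^ d * (a / N : ℝ) ^ d) * #(coreSets V k₁ k₂ M) := by
        gcongr
        exact choose_le_three_mul_div_pow N hd0
    _ = N * (3 * a / d : ℝ) ^ d * #(coreSets V k₁ k₂ M) := by
        rw [← mul_pow]
        congr 3
        field_simp
    _ ≤ _ := by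
        gcongr _ * ?_ ^ _ * _
        rw [div_le_iff₀ hd0']
        have : (6 * a : ℝ) ≤ d := by exact_mod_cast hd'
        linarith

end RareEvents

/-! ### Reversal, which interchanges the roles of `k₁` and `k₂` -/

section Reverse

variable {V : Type*}

/-- The edge set with all edges reversed. -/
def reverse (E : Finset (V × V)) : Finset (V × V) := E.map (Equiv.prodComm V V).toEmbedding

@[simp] lemma mem_reverse {E : Finset (V × V)} {a b : V} : (a, b) ∈ reverse E ↔ (b, a) ∈ E := by
  simp [reverse]

lemma card_reverse (E : Finset (V × V)) : #(reverse E) = #E := card_map _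

@[simp] lemma reverse_reverse (E : Finset (V × V)) : reverse (reverse E) = E := by
  ext ⟨a, b⟩; simp

variable [DecidableEq V] [Fintype V] {k₁ k₂ M : ℕ}

lemma outDegree_reverse (E : Finset (V × V)) (v : V) : outDegree (reverse E) v = inDegree E v := by
  rw [outDegree_eq_card, inDegree_eq_card]; simp

lemma inDegree_reverse (E : Finset (V × V)) (v : V) : inDegree (reverse E) v = outDegree E v := by
  rw [outDegree_eq_card, inDegree_eq_card]; simp

lemma reverse_mem_coreSets {E : Finset (V × V)} (hE : E ∈ coreSets V k₁ k₂ M) :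
    reverse E ∈ coreSets V k₂ k₁ M := by
  obtain ⟨h1, h2, h3⟩ := mem_coreSets.1 hE
  refine mem_coreSets.2 ⟨?_, fun v => ?_, by rw [card_reverse, h3]⟩
  · rintro ⟨a, b⟩ he
    exact (h1 _ (mem_reverse.1 he)).symm
  · rw [inDegree_reverse, outDegree_reverse]
    exact (h2 v).symm

open scoped Classical in
lemma card_filter_reverse (p : Finset (V × V) → Prop) :
    #((coreSets V k₁ k₂ M).filter fun E => p (reverse E)) = #((coreSets V k₂ k₁ M).filter p) := by
  refine card_bij (fun E _ => reverse E) ?_ ?_ ?_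
  · intro E hE
    obtain ⟨h1, h2⟩ := mem_filter.1 hE
    exact mem_filter.2 ⟨reverse_mem_coreSets h1, h2⟩
  · intro E _ E' _ h
    rw [← reverse_reverse E, h, reverse_reverse]
  · intro E hE
    obtain ⟨h1, h2⟩ := mem_filter.1 hE
    exact ⟨reverse E, mem_filter.2 ⟨reverse_mem_coreSets h1, by simpa using h2⟩, by simp⟩

lemma card_coreSets_comm : #(coreSets V k₁ k₂ M) = #(coreSets V k₂ k₁ M) := by
  simpa using card_filter_reverse (V := V) (k₁ := k₁) (k₂ := k₂) (M := M) fun _ => True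

end Reverse

/-! ### Exploration of the vertices reachable outside a deleted set -/

section Explore

variable {V : Type*}

/-- Adjacency in the digraph with edge set `E` after deletion of `T`. -/
def AdjAvoiding (E : Finset (V × V)) (T : Finset V) (a b : V) : Prop :=
  a ∉ T ∧ b ∉ T ∧ (a, b) ∈ E

lemma adjAvoiding_reverse {E : Finset (V × V)} {T : Finset V} :
    AdjAvoiding (reverse E) T = Function.swap (AdjAvoiding E T) := by
  ext a b
  simp only [AdjAvoiding, Function.swap, mem_reverse]
  tauto

variable [DecidableEq V]

/-- The heads of the edges with tail in `X`. -/
def outNeighbors (E : Finset (V × V)) (X : Finset V) : Finset V :=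
  (E.filter fun e => e.1 ∈ X).image Prod.snd

lemma mem_outNeighbors {E : Finset (V × V)} {X : Finset V} {y : V} :
    y ∈ outNeighbors E X ↔ ∃ x ∈ X, (x, y) ∈ E := by
  simp only [outNeighbors, mem_image, mem_filter, Prod.exists]
  constructor
  · rintro ⟨a, b, ⟨h1, h2⟩, rfl⟩; exact ⟨a, h2, h1⟩
  · rintro ⟨x, h1, h2⟩; exact ⟨x, y, ⟨h2, h1⟩, rfl⟩

lemma outNeighbors_congr {E E' : Finset (V × V)} {X : Finset V}
    (h : ∀ e : V × V, e.1 ∈ X → (e ∈ E ↔ e ∈ E')) : outNeighbors E X = outNeighbors E' X := by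
  ext y
  simp only [mem_outNeighbors]
  exact exists_congr fun x => and_congr_right fun hx => h (x, y) hx

open scoped Classical in
/-- The set of the first `n` vertices found when exploring from `u` outside `T`. The choice of the
next vertex depends only on the edges leaving the vertices explored so far. -/
noncomputable def explore (E : Finset (V × V)) (T : Finset V) (u : V) : ℕ → Finset V
  | 0 => ∅
  | n + 1 =>
    if h : ((insert u (outNeighbors E (explore E T u n)) \ explore E T u n) \ T).Nonempty then
      insert h.choose (explore E T u n)
    else explore E T u n

lemma explore_succ_of_nonempty {E : Finset (V × V)} {T : Finset V} {u : V} {n : ℕ}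
    (h : ((insert u (outNeighbors E (explore E T u n)) \ explore E T u n) \ T).Nonempty) :
    explore E T u (n + 1) = insert h.choose (explore E T u n) := by
  rw [explore, dif_pos h]

lemma explore_succ_of_not_nonempty {E : Finset (V × V)} {T : Finset V} {u : V} {n : ℕ}
    (h : ¬ ((insert u (outNeighbors E (explore E T u n)) \ explore E T u n) \ T).Nonempty) :
    explore E T u (n + 1) = explore E T u n := by
  rw [explore, dif_neg h]

lemma explore_subset_succ (E : Finset (V × V)) (T : Finset V) (u : V) (n : ℕ) :
    explore E T u n ⊆ explore E T u (n + 1) := by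
  by_cases h : ((insert u (outNeighbors E (explore E T u n)) \ explore E T u n) \ T).Nonempty
  · rw [explore_succ_of_nonempty h]; exact subset_insert _ _
  · rw [explore_succ_of_not_nonempty h]

lemma notMem_of_mem_explore {E : Finset (V × V)} {T : Finset V} {u : V} {n : ℕ} {x : V}
    (hx : x ∈ explore E T u n) : x ∉ T := by
  induction n with
  | zero => simp [explore] at hx
  | succ n ih =>
    by_cases h : ((insert u (outNeighbors E (explore E T u n)) \ explore E T u n) \ T).Nonempty
    · rw [explore_succ_of_nonempty h] at hx
      rcases mem_insert.1 hx with rfl | hx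
      · exact (mem_sdiff.1 h.choose_spec).2
      · exact ih hx
    · rw [explore_succ_of_not_nonempty h] at hx
      exact ih hx

/-- The next vertex is a function of the set of candidates, which is determined by `u`, `T` and the
edges leaving explored vertices. Switching other edges therefore cannot disturb the exploration. -/
lemma explore_congr {E E' : Finset (V × V)} {T : Finset V} {u : V} {n : ℕ}
    (h : ∀ e : V × V, e.1 ∈ explore E T u n → (e ∈ E ↔ e ∈ E')) :
    explore E' T u n = explore E T u n := by
  induction n with
  | zero => rfl
  | succ n ih =>
    have hsub := explore_subset_succ E T u n
    have h1 := ih fun e he => h e (hsub he)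
    have h2 := outNeighbors_congr (X := explore E T u n) fun e he => h e (hsub he)
    have h3 : (insert u (outNeighbors E' (explore E' T u n)) \ explore E' T u n) \ T =
        (insert u (outNeighbors E (explore E T u n)) \ explore E T u n) \ T := by
      rw [h1, ← h2]
    by_cases hne : ((insert u (outNeighbors E (explore E T u n)) \ explore E T u n) \ T).Nonempty
    -- The chosen element depends on the set alone, not on the proof that it is nonempty.
    · have hch : ∀ (S S' : Finset V) (hS : S.Nonempty) (hS' : S'.Nonempty), S = S' →
          hS.choose = hS'.choose := by
        rintro S _ _ _ rfl; rfl
      have hne' := hne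
      rw [← h3] at hne'
      rw [explore_succ_of_nonempty hne, explore_succ_of_nonempty hne', hch _ _ hne' hne h3, h1]
    · rw [explore_succ_of_not_nonempty hne, explore_succ_of_not_nonempty (h3 ▸ hne), h1]

lemma reflTransGen_of_mem_explore {E : Finset (V × V)} {T : Finset V} {u : V} {n : ℕ} {x : V}
    (hx : x ∈ explore E T u n) : Relation.ReflTransGen (AdjAvoiding E T) u x := by
  induction n generalizing x with
  | zero => simp [explore] at hx
  | succ n ih =>
    by_cases h : ((insert u (outNeighbors E (explore E T u n)) \ explore E T u n) \ T).Nonempty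
    · rw [explore_succ_of_nonempty h] at hx
      rcases mem_insert.1 hx with hx | hx
      · have hc := h.choose_spec
        rw [← hx] at hc
        simp only [mem_sdiff, mem_insert] at hc
        obtain ⟨⟨rfl | h1, -⟩, h2⟩ := hc
        · exact .refl
        · obtain ⟨z, hz, hzx⟩ := mem_outNeighbors.1 h1
          exact (ih hz).tail ⟨notMem_of_mem_explore hz, h2, hzx⟩
      · exact ih hx
    · rw [explore_succ_of_not_nonempty h] at hx
      exact ih hx

/-- The exploration can get stuck only at a nonempty set `X` all of whose edges stay in `X ∪ T`. -/
lemma card_explore {E : Finset (V × V)} {T : Finset V} {u : V} (hu : u ∉ T) {n : ℕ}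
    (h : ∀ X : Finset V, X.Nonempty → #X < n → ¬ Confined E X (X ∪ T)) :
    #(explore E T u n) = n := by
  induction n with
  | zero => rfl
  | succ n ih =>
    have hn := ih fun X hX hc => h X hX (by omega)
    have hne : ((insert u (outNeighbors E (explore E T u n)) \ explore E T u n) \ T).Nonempty := by
      rcases (explore E T u n).eq_empty_or_nonempty with h0 | h0
      · exact ⟨u, by simp [h0, hu]⟩
      · have := h _ h0 (by omega)
        simp only [Confined, not_forall] at this
        obtain ⟨⟨a, b⟩, hE, ha, hb⟩ := this
        simp only [mem_union, not_or] at hb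
        refine ⟨b, ?_⟩
        simp only [mem_sdiff, mem_insert]
        exact ⟨⟨Or.inr (mem_outNeighbors.2 ⟨a, ha, hE⟩), hb.1⟩, hb.2⟩
    rw [explore_succ_of_nonempty hne, card_insert_of_notMem, hn]
    exact (mem_sdiff.1 (mem_sdiff.1 hne.choose_spec).1).2

/-- The vertices outside `T` found but not yet explored. -/
noncomputable def frontier (E : Finset (V × V)) (T : Finset V) (u : V) (n : ℕ) : Finset V :=
  (outNeighbors E (explore E T u n) \ explore E T u n) \ T

lemma frontier_congr {E E' : Finset (V × V)} {T : Finset V} {u : V} {n : ℕ}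
    (h : ∀ e : V × V, e.1 ∈ explore E T u n → (e ∈ E ↔ e ∈ E')) :
    frontier E' T u n = frontier E T u n := by
  rw [frontier, frontier, explore_congr h, outNeighbors_congr h]

lemma mem_frontier {E : Finset (V × V)} {T : Finset V} {u : V} {n : ℕ} {y : V} :
    y ∈ frontier E T u n ↔
      ((∃ x ∈ explore E T u n, (x, y) ∈ E) ∧ y ∉ explore E T u n) ∧ y ∉ T := by
  simp [frontier, mem_outNeighbors]

lemma reflTransGen_of_mem_frontier {E : Finset (V × V)} {T : Finset V} {u : V} {n : ℕ} {x : V}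
    (hx : x ∈ frontier E T u n) : Relation.ReflTransGen (AdjAvoiding E T) u x := by
  obtain ⟨⟨⟨z, hz, hzx⟩, -⟩, h2⟩ := mem_frontier.1 hx
  exact (reflTransGen_of_mem_explore hz).tail ⟨notMem_of_mem_explore hz, h2, hzx⟩

end Explore

/-! ### Switchings that create edges between the two frontiers -/

section Connect

variable {V : Type*} [DecidableEq V] {k₁ k₂ M : ℕ}

/-- The edges from the frontier of the exploration from `u` to the frontier of the backward
exploration from `v`. -/
noncomputable def crossing (T : Finset V) (u v : V) (n : ℕ) (E : Finset (V × V)) :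
    Finset (V × V) :=
  E.filter fun e => e.1 ∈ frontier E T u n ∧ e.2 ∈ frontier (reverse E) T v n

/-- The two explorations are disjoint with frontiers of size at least `q`, all degrees are at most
`Δ`, and `j` edges join the frontiers. -/
structure Separated (T : Finset V) (u v : V) (n q Δ j : ℕ) (E : Finset (V × V)) : Prop where
  degrees : ∀ w, outDegree E w ≤ Δ ∧ inDegree E w ≤ Δ
  disjoint : Disjoint (explore E T u n ∪ frontier E T u n)
    (explore (reverse E) T v n ∪ frontier (reverse E) T v n)
  left : q ≤ #(frontier E T u n)
  right : q ≤ #(frontier (reverse E) T v n)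
  card_crossing : #(crossing T u v n E) = j

variable [Fintype V]

/-- The pairs of edges, one leaving the first frontier and one entering the second, whose swap
creates exactly one crossing edge. -/
noncomputable def crossPairs (T : Finset V) (u v : V) (n : ℕ) (E : Finset (V × V)) :
    Finset ((V × V) × (V × V)) :=
  ((E.filter fun e => e.1 ∈ frontier E T u n ∧ e.2 ∉ frontier (reverse E) T v n) ×ˢ
    (E.filter fun e => e.2 ∈ frontier (reverse E) T v n ∧ e.1 ∉ frontier E T u n)).filter
    fun p => (p.1.1, p.2.2) ∉ E ∧ (p.2.1, p.1.2) ∉ E ∧ p.2.1 ≠ p.1.2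

/-- At least `2 * #Q` edges leave the first frontier `Q` and only `j ≤ q ≤ #Q` of them cross, so at
least `q` do not; likewise for edges entering the second. For a given `(a, y)`, each of the three
conditions on `(x, b)` excludes at most `Δ * Δ` partners. -/
lemma card_crossPairs {T : Finset V} {u v : V} {n q Δ j : ℕ} {E : Finset (V × V)}
    (hE : E ∈ coreSets V k₁ k₂ M) (hk₁ : 2 ≤ k₁) (hk₂ : 2 ≤ k₂)
    (h : Separated T u v n q Δ j E) (hj : j ≤ q) :
    q * (q - 3 * (Δ * Δ)) ≤ #(crossPairs T u v n E) := by
  obtain ⟨hloop, hdeg, hM⟩ := mem_coreSets.1 hE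
  set Q := frontier E T u n with hQ
  set Q' := frontier (reverse E) T v n with hQ'
  set A := E.filter fun e => e.1 ∈ Q ∧ e.2 ∉ Q' with hA
  set B := E.filter fun e => e.2 ∈ Q' ∧ e.1 ∉ Q with hB
  have hcross : crossing T u v n E = E.filter fun e => e.1 ∈ Q ∧ e.2 ∈ Q' := rfl
  have hcr := h.card_crossing
  have hAq : q ≤ #A := by
    have h1 : 2 * #Q ≤ #(E.filter fun e => e.1 ∈ Q) := by
      rw [card_filter_fst_mem]
      calc 2 * #Q = ∑ v ∈ Q, 2 := by simp [mul_comm]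
        _ ≤ _ := sum_le_sum fun w _ => hk₂.trans (hdeg w).2
    have h2 : (E.filter fun e => e.1 ∈ Q) ⊆ A ∪ crossing T u v n E := by
      intro e
      simp only [hcross, hA, mem_union, mem_filter]
      tauto
    have h3 := (card_le_card h2).trans (card_union_le _ _)
    have : q ≤ #Q := h.left
    omega
  have hBq : q ≤ #B := by
    have h1 : 2 * #Q' ≤ #(E.filter fun e => e.2 ∈ Q') := by
      rw [card_filter_snd_mem]
      calc 2 * #Q' = ∑ v ∈ Q', 2 := by simp [mul_comm]
        _ ≤ _ := sum_le_sum fun w _ => hk₁.trans (hdeg w).1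
    have h2 : (E.filter fun e => e.2 ∈ Q') ⊆ B ∪ crossing T u v n E := by
      intro e
      simp only [hcross, hB, mem_union, mem_filter]
      tauto
    have h3 := (card_le_card h2).trans (card_union_le _ _)
    have : q ≤ #Q' := h.right
    omega
  have hinner : ∀ e ∈ A, q - 3 * (Δ * Δ) ≤
      #(B.filter fun f => (e.1, f.2) ∉ E ∧ (f.1, e.2) ∉ E ∧ f.1 ≠ e.2) := by
    rintro ⟨a, y⟩ he
    have h1 : B ⊆ (B.filter fun f => (a, f.2) ∉ E ∧ (f.1, y) ∉ E ∧ f.1 ≠ y) ∪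
        (E.filter fun f => f.2 ∈ univ.filter fun b => (a, b) ∈ E) ∪
        (E.filter fun f => f.1 ∈ univ.filter fun x => (x, y) ∈ E) ∪
        (E.filter fun f => f.1 = y) := by
      intro f hf
      have hfE := (mem_filter.1 hf).1
      simp only [mem_union, mem_filter, hf, hfE, mem_univ, true_and]
      tauto
    have h2 : #(E.filter fun f => f.2 ∈ univ.filter fun b => (a, b) ∈ E) ≤ Δ * Δ := by
      rw [card_filter_snd_mem]
      refine (sum_le_sum fun w _ => (h.degrees w).2).trans ?_
      rw [sum_const, smul_eq_mul, ← outDegree_eq_card]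
      exact Nat.mul_le_mul_right _ (h.degrees a).1
    have h3 : #(E.filter fun f => f.1 ∈ univ.filter fun x => (x, y) ∈ E) ≤ Δ * Δ := by
      rw [card_filter_fst_mem]
      refine (sum_le_sum fun w _ => (h.degrees w).1).trans ?_
      rw [sum_const, smul_eq_mul, ← inDegree_eq_card]
      exact Nat.mul_le_mul_right _ (h.degrees y).2
    have h4 : #(E.filter fun f => f.1 = y) ≤ Δ * Δ :=
      (h.degrees y).1.trans (Nat.le_mul_self Δ)
    have h5 := card_le_card h1
    have h6 := card_union_le ((B.filter fun f => (a, f.2) ∉ E ∧ (f.1, y) ∉ E ∧ f.1 ≠ y) ∪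
        (E.filter fun f => f.2 ∈ univ.filter fun b => (a, b) ∈ E) ∪
        (E.filter fun f => f.1 ∈ univ.filter fun x => (x, y) ∈ E)) (E.filter fun f => f.1 = y)
    have h7 := card_union_le ((B.filter fun f => (a, f.2) ∉ E ∧ (f.1, y) ∉ E ∧ f.1 ≠ y) ∪
        (E.filter fun f => f.2 ∈ univ.filter fun b => (a, b) ∈ E))
        (E.filter fun f => f.1 ∈ univ.filter fun x => (x, y) ∈ E)
    have h8 := card_union_le (B.filter fun f => (a, f.2) ∉ E ∧ (f.1, y) ∉ E ∧ f.1 ≠ y)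
        (E.filter fun f => f.2 ∈ univ.filter fun b => (a, b) ∈ E)
    simp only
    omega
  calc q * (q - 3 * (Δ * Δ)) ≤ #A * (q - 3 * (Δ * Δ)) := Nat.mul_le_mul_right _ hAq
    _ = ∑ e ∈ A, (q - 3 * (Δ * Δ)) := by simp
    _ ≤ ∑ e ∈ A, #(B.filter fun f => (e.1, f.2) ∉ E ∧ (f.1, e.2) ∉ E ∧ f.1 ≠ e.2) :=
        sum_le_sum hinner
    _ = #(crossPairs T u v n E) := by
        rw [crossPairs, card_filter, sum_product]
        exact sum_congr rfl fun e _ => card_filter _ _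

/-- The tails `a`, `x` are unexplored forwards and the heads `b`, `y` unexplored backwards, so both
explorations and frontiers survive. Of the four edges concerned only the new `(a, b)` crosses. -/
lemma Separated.exchange {T : Finset V} {u v : V} {n q Δ j : ℕ} {E : Finset (V × V)}
    (hE : E ∈ coreSets V k₁ k₂ M) (h : Separated T u v n q Δ j E)
    {a y x b : V} (hp : ((a, y), (x, b)) ∈ crossPairs T u v n E) :
    {(a, y), (x, b)} ⊆ E ∧ Disjoint E {(a, b), (x, y)} ∧
      exchange E {(a, y), (x, b)} {(a, b), (x, y)} ∈ coreSets V k₁ k₂ M ∧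
      Separated T u v n q Δ (j + 1) (exchange E {(a, y), (x, b)} {(a, b), (x, y)}) ∧
      (a, b) ∈ crossing T u v n (exchange E {(a, y), (x, b)} {(a, b), (x, y)}) := by
  simp only [crossPairs, mem_filter, mem_product] at hp
  obtain ⟨⟨⟨hay, haQ, hyQ⟩, hxb, hbQ, hxQ⟩, hab, hxy, hne⟩ := hp
  have hdisj := Finset.disjoint_left.1 h.disjoint
  have haX : a ∉ explore E T u n := (mem_frontier.1 haQ).1.2
  have haT : a ∉ T := (mem_frontier.1 haQ).2
  have hbY : b ∉ explore (reverse E) T v n := (mem_frontier.1 hbQ).1.2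
  have hbT : b ∉ T := (mem_frontier.1 hbQ).2
  -- Otherwise the edge `(x, b)` would bring `b` into the forward region, although `b` lies in the
  -- backward frontier.
  have hxX : x ∉ explore E T u n := by
    intro hx
    refine hdisj (a := b) ?_ (mem_union_right _ hbQ)
    by_cases hb : b ∈ explore E T u n
    · exact mem_union_left _ hb
    · exact mem_union_right _ (mem_frontier.2 ⟨⟨⟨x, hx, hxb⟩, hb⟩, hbT⟩)
  have hyY : y ∉ explore (reverse E) T v n := by
    intro hy
    refine hdisj (a := a) (mem_union_right _ haQ) ?_
    by_cases ha : a ∈ explore (reverse E) T v n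
    · exact mem_union_left _ ha
    · exact mem_union_right _ (mem_frontier.2 ⟨⟨⟨y, hy, mem_reverse.2 hay⟩, ha⟩, haT⟩)
  have hanb : a ≠ b := by
    rintro rfl
    exact hdisj (mem_union_right _ haQ) (mem_union_right _ hbQ)
  have hyb : y ≠ b := by rintro rfl; exact hyQ hbQ
  have hR : {(a, y), (x, b)} ⊆ E := by simp [insert_subset_iff, hay, hxb]
  have hA : Disjoint E {(a, b), (x, y)} := by simp [hab, hxy]
  have hn1 : (a, y) ≠ (x, b) := by simp [hyb]
  have hn2 : (a, b) ≠ (x, y) := by simp [hyb.symm]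
  have hin : ∀ w, #(({(a, y), (x, b)} : Finset (V × V)).filter fun e => e.2 = w) =
      #(({(a, b), (x, y)} : Finset (V × V)).filter fun e => e.2 = w) := by
    intro w
    rw [card_filter_pair hn1, card_filter_pair hn2, add_comm]
  have hout : ∀ w, #(({(a, y), (x, b)} : Finset (V × V)).filter fun e => e.1 = w) =
      #(({(a, b), (x, y)} : Finset (V × V)).filter fun e => e.1 = w) := by
    intro w
    rw [card_filter_pair hn1, card_filter_pair hn2]
  set E' := DirectedCore.exchange E {(a, y), (x, b)} {(a, b), (x, y)} with hE'
  have hmem : ∀ e : V × V, e.1 ≠ a → e.1 ≠ x → (e ∈ E ↔ e ∈ E') := by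
    rintro ⟨s, t⟩ h1 h2
    simp only at h1 h2
    simp [hE', DirectedCore.exchange, h1, h2]
  have hmem' : ∀ e : V × V, e.1 ≠ b → e.1 ≠ y → (e ∈ reverse E ↔ e ∈ reverse E') := by
    rintro ⟨s, t⟩ h1 h2
    simp only at h1 h2
    simp [hE', DirectedCore.exchange, h1, h2]
  have hX : ∀ e : V × V, e.1 ∈ explore E T u n → (e ∈ E ↔ e ∈ E') := fun e he =>
    hmem e (fun h => haX (h ▸ he)) (fun h => hxX (h ▸ he))
  have hY : ∀ e : V × V, e.1 ∈ explore (reverse E) T v n → (e ∈ reverse E ↔ e ∈ reverse E') :=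
    fun e he => hmem' e (fun h => hbY (h ▸ he)) (fun h => hyY (h ▸ he))
  have e1 := explore_congr hX
  have e2 := explore_congr hY
  have f1 := frontier_congr hX
  have f2 := frontier_congr hY
  have hcr : crossing T u v n E' =
      E'.filter fun e => e.1 ∈ frontier E T u n ∧ e.2 ∈ frontier (reverse E) T v n := by
    rw [crossing, f1, f2]
  refine ⟨hR, hA, exchange_mem_coreSets hE hR hA (by rw [card_pair hn1, card_pair hn2])
    (by simp [hanb, hne]) (fun w => ?_) (fun w => ?_), ⟨fun w => ?_, ?_, ?_, ?_, ?_⟩, ?_⟩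
  · rw [hin w]; exact Nat.add_le_add_right ((mem_coreSets.1 hE).2.1 w).1 _
  · rw [hout w]; exact Nat.add_le_add_right ((mem_coreSets.1 hE).2.1 w).2 _
  · have h1 := inDegree_exchange hR hA w
    have h2 := outDegree_exchange hR hA w
    rw [hin w, ← hE'] at h1
    rw [hout w, ← hE'] at h2
    have := h.degrees w
    omega
  · rw [e1, e2, f1, f2]; exact h.disjoint
  · rw [f1]; exact h.left
  · rw [f2]; exact h.right
  · have h1 := card_filter_exchange hR hA
      (fun e => e.1 ∈ frontier E T u n ∧ e.2 ∈ frontier (reverse E) T v n)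
    have h2 : #(E.filter fun e => e.1 ∈ frontier E T u n ∧ e.2 ∈ frontier (reverse E) T v n) = j :=
      h.card_crossing
    rw [card_filter_pair hn1, card_filter_pair hn2, h2, ← hE'] at h1
    rw [hcr]
    simpa [haQ, hyQ, hxQ, hbQ] using h1
  · rw [hcr]
    simp [hE', DirectedCore.exchange, haQ, hbQ]

-- To undo a swap, name the crossing edge `(a, b)` among `j + 1` and the edge `(x, y)` among `M`.
open scoped Classical in
lemma card_separated_step {T : Finset V} {u v : V} {n q Δ j : ℕ} (hk₁ : 2 ≤ k₁) (hk₂ : 2 ≤ k₂)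
    (hj : j ≤ q) :
    #((coreSets V k₁ k₂ M).filter (Separated T u v n q Δ j)) * (q * (q - 3 * (Δ * Δ))) ≤
      #((coreSets V k₁ k₂ M).filter (Separated T u v n q Δ (j + 1))) * ((j + 1) * M) := by
  refine card_mul_le_of_exchange _ _ (crossPairs T u v n)
    (fun E => (crossing T u v n E ×ˢ E).image fun p => ((p.1.1, p.2.2), (p.2.1, p.1.2)))
    (fun p => {p.1, p.2}) (fun p => {(p.1.1, p.2.2), (p.2.1, p.1.2)}) ?_ ?_ ?_
  · rintro E hE ⟨⟨a, y⟩, ⟨x, b⟩⟩ hp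
    obtain ⟨hcore, hsep⟩ := mem_filter.1 hE
    obtain ⟨h1, h2, h3, h4, h5⟩ := hsep.exchange hcore hp
    refine ⟨h1, h2, mem_filter.2 ⟨h3, h4⟩, mem_image.2 ⟨((a, b), (x, y)), ?_, rfl⟩⟩
    exact mem_product.2 ⟨h5, mem_union_right _ (by simp)⟩
  · intro E hE
    obtain ⟨hcore, hsep⟩ := mem_filter.1 hE
    exact card_crossPairs hcore hk₁ hk₂ hsep hj
  · intro E hE
    obtain ⟨hcore, hsep⟩ := mem_filter.1 hE
    refine card_image_le.trans ?_
    rw [card_product, hsep.card_crossing, (mem_coreSets.1 hcore).2.2]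

-- Telescoping over the number of crossing edges: each of the `J` steps gains a factor `2 * J * M /
-- q ^ 2`, which is O(1/N) when `q` is linear in N and `J` is fixed.
open scoped Classical in
theorem card_separated_zero_le {T : Finset V} {u v : V} {n q Δ : ℕ} (hk₁ : 2 ≤ k₁)
    (hk₂ : 2 ≤ k₂) (hΔ : 6 * (Δ * Δ) ≤ q) {J : ℕ} (hJ : J ≤ q) :
    #((coreSets V k₁ k₂ M).filter (Separated T u v n q Δ 0)) * (q * q) ^ J ≤
      #(coreSets V k₁ k₂ M) * (2 * (J * M)) ^ J := by
  have key : ∀ j ≤ J, #((coreSets V k₁ k₂ M).filter (Separated T u v n q Δ 0)) * (q * q) ^ j ≤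
      #((coreSets V k₁ k₂ M).filter (Separated T u v n q Δ j)) * (2 * (J * M)) ^ j := by
    intro j hj
    induction j with
    | zero => simp
    | succ j ih =>
      have h1 := ih (by omega)
      have h2 := card_separated_step (V := V) (k₁ := k₁) (k₂ := k₂) (M := M) (T := T) (u := u)
        (v := v) (n := n) (q := q) (Δ := Δ) (j := j) hk₁ hk₂ (by omega)
      -- The degree bound makes `q - 3 * (Δ * Δ)` at least `q / 2`.
      have h3 : q * q ≤ 2 * (q * (q - 3 * (Δ * Δ))) := by
        calc q * q ≤ q * (2 * (q - 3 * (Δ * Δ))) := Nat.mul_le_mul_left _ (by omega)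
          _ = _ := by ring
      set s := fun j => #((coreSets V k₁ k₂ M).filter (Separated T u v n q Δ j))
      change s 0 * (q * q) ^ (j + 1) ≤ s (j + 1) * (2 * (J * M)) ^ (j + 1)
      change s 0 * (q * q) ^ j ≤ s j * (2 * (J * M)) ^ j at h1
      change s j * (q * (q - 3 * (Δ * Δ))) ≤ s (j + 1) * ((j + 1) * M) at h2
      calc s 0 * (q * q) ^ (j + 1) = (s 0 * (q * q) ^ j) * (q * q) := by ring
        _ ≤ (s j * (2 * (J * M)) ^ j) * (2 * (q * (q - 3 * (Δ * Δ)))) := Nat.mul_le_mul h1 h3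
        _ = (s j * (q * (q - 3 * (Δ * Δ)))) * 2 * (2 * (J * M)) ^ j := by ring
        _ ≤ (s (j + 1) * ((j + 1) * M)) * 2 * (2 * (J * M)) ^ j := by gcongr
        _ ≤ (s (j + 1) * (J * M)) * 2 * (2 * (J * M)) ^ j := by gcongr
        _ = _ := by ring
  exact (key J le_rfl).trans (Nat.mul_le_mul_right _ (card_le_card (filter_subset _ _)))

end Connect

/-! ### Failure of reachability: a rare local event or a separated pair -/

section Dichotomy

variable {V : Type*} [DecidableEq V] [Fintype V] {k₁ k₂ M : ℕ}

/-- Singletons, which traps omit, are excluded by degrees: without loops, the more than `s`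
out-neighbours of a vertex cannot all lie in `T`. -/
lemma not_confined_of_not_hasTrap {s L : ℕ} {E : Finset (V × V)}
    (hE : E ∈ coreSets V k₁ k₂ M) (hs : s < k₂) (hsV : s ≤ Fintype.card V) (h : ¬ HasTrap s L E)
    {T : Finset V} (hT : #T ≤ s) {X : Finset V} (hX : X.Nonempty) (hXL : #X ≤ L) :
    ¬ Confined E X (X ∪ T) := by
  intro hc
  have hX2 : 2 ≤ #X := by
    by_contra hlt
    have h1 : #X = 1 := by have := hX.card_pos; omega
    obtain ⟨x, rfl⟩ := card_eq_one.1 h1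
    have h2 := ((mem_coreSets.1 hE).2.1 x).2
    rw [outDegree_eq_card] at h2
    have h3 : (univ.filter fun y => (x, y) ∈ E) ⊆ T := by
      intro y hy
      have hy := (mem_filter.1 hy).2
      have := hc _ hy (mem_singleton_self x)
      rcases mem_union.1 this with h | h
      · exact absurd (mem_singleton.1 h).symm ((mem_coreSets.1 hE).1 _ hy)
      · exact h
    have := card_le_card h3
    omega
  -- Traps ask for exactly `s` exits, so `T` is padded.
  obtain ⟨T', hTT', hT'⟩ := exists_superset_card_eq hT hsV
  exact h ⟨X, T', hX2, hXL, hT', fun e he hx => union_subset_union_right hTT' (hc e he hx)⟩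

/-- Absence of traps lets the exploration reach `2 * w` vertices. Absence of poor expansion then
gives more than `w` further out-neighbours, at most `s` of them deleted. -/
lemma card_frontier_ge {s w q : ℕ} {E : Finset (V × V)}
    (hE : E ∈ coreSets V k₁ k₂ M) (hs : s < k₂) (hsV : s ≤ Fintype.card V)
    (hw : w ≤ Fintype.card V) (hq : q + s ≤ w)
    (h : ¬ HasTrap s (2 * w) E) (h' : ¬ ExpandsPoorly w E)
    {T : Finset V} (hT : #T ≤ s) {u : V} (hu : u ∉ T) : q ≤ #(frontier E T u (2 * w)) := by
  have hX : #(explore E T u (2 * w)) = 2 * w := card_explore hu fun X hX hc =>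
    not_confined_of_not_hasTrap hE hs hsV h hT hX hc.le
  set X := explore E T u (2 * w) with hXdef
  have h1 : w < #(outNeighbors E X \ X) := by
    by_contra hle
    obtain ⟨W, hW, hWc⟩ := exists_superset_card_eq (not_lt.1 hle) hw
    refine h' ⟨X, W, hX, hWc, fun e he hx => ?_⟩
    by_cases hx' : e.2 ∈ X
    · exact mem_union_left _ hx'
    · exact mem_union_right _ (hW (mem_sdiff.2 ⟨mem_outNeighbors.2 ⟨e.1, hx, he⟩, hx'⟩))
  have h2 := le_card_sdiff T (outNeighbors E X \ X)
  change q ≤ #((outNeighbors E X \ X) \ T)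
  omega

/-- Either one of the rare local events occurs, or the deletion of `T` separates `u` from `v` in
such a way that the explored neighbourhoods are large and not joined by an edge. -/
lemma separated_of_not_reflTransGen {s w q Δ : ℕ} {E : Finset (V × V)}
    (hE : E ∈ coreSets V k₁ k₂ M) (hs₁ : s < k₁) (hs₂ : s < k₂) (hsV : s ≤ Fintype.card V)
    (hw : w ≤ Fintype.card V) (hq : q + s ≤ w)
    (h : ¬ HasTrap s (2 * w) E) (h' : ¬ ExpandsPoorly w E)
    (hr : ¬ HasTrap s (2 * w) (reverse E)) (hr' : ¬ ExpandsPoorly w (reverse E))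
    (hΔ : ∀ w, outDegree E w ≤ Δ ∧ inDegree E w ≤ Δ)
    {T : Finset V} (hT : #T ≤ s) {u v : V} (hu : u ∉ T) (hv : v ∉ T)
    (huv : ¬ Relation.ReflTransGen (AdjAvoiding E T) u v) :
    Separated T u v (2 * w) q Δ 0 E := by
  have hleft : ∀ x ∈ explore E T u (2 * w) ∪ frontier E T u (2 * w),
      Relation.ReflTransGen (AdjAvoiding E T) u x := by
    intro x hx
    rcases mem_union.1 hx with hx | hx
    · exact reflTransGen_of_mem_explore hx
    · exact reflTransGen_of_mem_frontier hx
  have hright : ∀ x ∈ explore (reverse E) T v (2 * w) ∪ frontier (reverse E) T v (2 * w),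
      Relation.ReflTransGen (AdjAvoiding E T) x v := by
    intro x hx
    have : Relation.ReflTransGen (AdjAvoiding (reverse E) T) v x := by
      rcases mem_union.1 hx with hx | hx
      · exact reflTransGen_of_mem_explore hx
      · exact reflTransGen_of_mem_frontier hx
    rw [adjAvoiding_reverse] at this
    exact Relation.reflTransGen_swap.1 this
  refine ⟨hΔ, ?_, card_frontier_ge hE hs₂ hsV hw hq h h' hT hu,
    card_frontier_ge (reverse_mem_coreSets hE) hs₁ hsV hw hq hr hr' hT hv, ?_⟩
  · rw [Finset.disjoint_left]
    intro x hx hx'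
    exact huv ((hleft x hx).trans (hright x hx'))
  · rw [card_eq_zero, crossing, filter_eq_empty_iff]
    rintro ⟨a, b⟩ hab ⟨ha, hb⟩
    refine huv ((hleft a (mem_union_right _ ha)).trans
      (.head ⟨(mem_frontier.1 ha).2, (mem_frontier.1 hb).2, hab⟩
        (hright b (mem_union_right _ hb))))

end Dichotomy

/-! ### Choice of parameters and the bound for separability -/

section Assembly

lemma exists_pow_le_mul_two_pow (p : ℕ) :
    ∃ K : ℝ, 0 ≤ K ∧ ∀ n : ℕ, (n : ℝ) ^ p ≤ K * 2 ^ n := by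
  have h := (tendsto_pow_const_div_const_pow_of_one_lt p (one_lt_two (α := ℝ))).bddAbove_range
  obtain ⟨K, hK⟩ := h
  have hK' : ∀ n : ℕ, (n : ℝ) ^ p / 2 ^ n ≤ K := fun n => hK ⟨n, rfl⟩
  refine ⟨K, le_trans (by positivity) (hK' 0), fun n => ?_⟩
  exact (div_le_iff₀ (by positivity)).1 (hK' n)

lemma edgeConst_comm (k₁ k₂ C : ℕ) : edgeConst k₁ k₂ C = edgeConst k₂ k₁ C := by
  rw [edgeConst, edgeConst]; ring

variable {V : Type*} [DecidableEq V]

/-- The deletion of some set of at most `s` vertices destroys strong connectivity. -/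
def Separable (s : ℕ) (E : Finset (V × V)) : Prop :=
  ∃ T : Finset V, #T ≤ s ∧ ∃ u ∉ T, ∃ v ∉ T, ¬ Relation.ReflTransGen (AdjAvoiding E T) u v

variable [Fintype V] {k₁ k₂ M : ℕ}

lemma card_filter_card_le {s : ℕ} (hV : 1 ≤ Fintype.card V) :
    #((univ : Finset (Finset V)).filter fun T => #T ≤ s) ≤ (s + 1) * Fintype.card V ^ s := by
  have h : ((univ : Finset (Finset V)).filter fun T => #T ≤ s) ⊆
      (range (s + 1)).biUnion fun i => powersetCard i univ := by
    intro T hT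
    have := (mem_filter.1 hT).2
    exact mem_biUnion.2 ⟨#T, mem_range.2 (by omega), mem_powersetCard.2 ⟨subset_univ _, rfl⟩⟩
  refine (card_le_card h).trans (card_biUnion_le.trans ?_)
  calc ∑ i ∈ range (s + 1), #(powersetCard i (univ : Finset V))
      ≤ ∑ i ∈ range (s + 1), Fintype.card V ^ s := by
        refine sum_le_sum fun i hi => ?_
        rw [card_powersetCard, card_univ]
        exact (Nat.choose_le_pow _ _).trans
          (Nat.pow_le_pow_right hV (by have := mem_range.1 hi; omega))
    _ = _ := by simp

open scoped Classical in
/-- A separable core exhibits one of the rare local events or a separated pair of vertices. -/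
lemma card_separable_le {s w q Δ : ℕ} (hs₁ : s < k₁) (hs₂ : s < k₂) (hsV : s ≤ Fintype.card V)
    (hw : w ≤ Fintype.card V) (hq : q + s ≤ w) :
    #((coreSets V k₁ k₂ M).filter (Separable s)) ≤
      #((coreSets V k₁ k₂ M).filter (HasTrap s (2 * w))) +
      #((coreSets V k₂ k₁ M).filter (HasTrap s (2 * w))) +
      #((coreSets V k₁ k₂ M).filter (ExpandsPoorly w)) +
      #((coreSets V k₂ k₁ M).filter (ExpandsPoorly w)) +
      #((coreSets V k₁ k₂ M).filter (HasLargeOutDegree (Δ + 1))) +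
      #((coreSets V k₂ k₁ M).filter (HasLargeOutDegree (Δ + 1))) +
      ∑ T ∈ (univ : Finset (Finset V)).filter (fun T => #T ≤ s), ∑ u : V, ∑ v : V,
        #((coreSets V k₁ k₂ M).filter (Separated T u v (2 * w) q Δ 0)) := by
  rw [← card_filter_reverse (k₁ := k₁) (k₂ := k₂) (HasTrap s (2 * w)),
    ← card_filter_reverse (k₁ := k₁) (k₂ := k₂) (ExpandsPoorly w),
    ← card_filter_reverse (k₁ := k₁) (k₂ := k₂) (HasLargeOutDegree (Δ + 1))]
  set 𝒟 := coreSets V k₁ k₂ M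
  set S := ((univ : Finset (Finset V)).filter fun T => #T ≤ s).biUnion fun T =>
    (univ : Finset V).biUnion fun u => (univ : Finset V).biUnion fun v =>
      𝒟.filter (Separated T u v (2 * w) q Δ 0) with hS
  have hcover : 𝒟.filter (Separable s) ⊆ 𝒟.filter (HasTrap s (2 * w)) ∪
      𝒟.filter (fun E => HasTrap s (2 * w) (reverse E)) ∪ 𝒟.filter (ExpandsPoorly w) ∪
      𝒟.filter (fun E => ExpandsPoorly w (reverse E)) ∪ 𝒟.filter (HasLargeOutDegree (Δ + 1)) ∪
      𝒟.filter (fun E => HasLargeOutDegree (Δ + 1) (reverse E)) ∪ S := by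
    intro E hE
    obtain ⟨hE, T, hT, u, hu, v, hv, huv⟩ := mem_filter.1 hE
    simp only [mem_union, mem_filter, hE, true_and]
    by_contra hcon
    simp only [not_or] at hcon
    obtain ⟨⟨⟨⟨⟨⟨h1, h2⟩, h3⟩, h4⟩, h5⟩, h6⟩, h7⟩ := hcon
    refine h7 ?_
    simp only [hS, mem_biUnion, mem_filter, mem_univ, true_and]
    refine ⟨T, hT, u, v, hE, separated_of_not_reflTransGen hE hs₁ hs₂ hsV hw hq h1 h3 h2 h4
      (fun x => ⟨?_, ?_⟩) hT hu hv huv⟩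
    · by_contra hlt
      exact h5 ⟨x, by omega⟩
    · by_contra hlt
      exact h6 ⟨x, by rw [outDegree_reverse]; omega⟩
  refine (card_le_card hcover).trans ((card_union_le _ _).trans (Nat.add_le_add ?_ ?_))
  · refine (card_union_le _ _).trans (Nat.add_le_add_right ?_ _)
    refine (card_union_le _ _).trans (Nat.add_le_add_right ?_ _)
    refine (card_union_le _ _).trans (Nat.add_le_add_right ?_ _)
    refine (card_union_le _ _).trans (Nat.add_le_add_right ?_ _)
    exact card_union_le _ _
  · exact card_biUnion_le.trans <| sum_le_sum fun T _ => card_biUnion_le.trans <|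
      sum_le_sum fun u _ => card_biUnion_le

/-- The order of magnitude of the probability of separability by `s` vertices. -/
noncomputable def rate (k s N : ℕ) : ℝ := (N : ℝ) ^ s / (N : ℝ) ^ (2 * (k - 1))

/-- The factor N^s of the rate is at least 1 and is given away. -/
lemma le_rate_of_pow_mul_le {k s N : ℕ} {x K : ℝ} (hN : 1 ≤ N) (hK : 0 ≤ K)
    (h : (N : ℝ) ^ (2 * (k - 1)) * x ≤ K) : x ≤ K * rate k s N := by
  have hN1 : (1 : ℝ) ≤ N := by exact_mod_cast hN
  rw [rate, ← mul_div_assoc, le_div_iff₀ (by positivity), mul_comm]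
  exact h.trans (le_mul_of_one_le_right hK (one_le_pow₀ hN1))

/-- As `w` is linear in N, exponential decay in `w` beats the power of N in the rate. -/
lemma two_pow_inv_le_rate {k s N w B : ℕ} {K : ℝ} (hN : 1 ≤ N) (hK : 0 ≤ K)
    (hNw : N ≤ B * (w + 1)) (hpoly : ∀ n : ℕ, (n : ℝ) ^ (2 * (k - 1)) ≤ K * 2 ^ n) :
    (1 / 2 : ℝ) ^ w ≤ 2 * (B : ℝ) ^ (2 * (k - 1)) * K * rate k s N := by
  refine le_rate_of_pow_mul_le hN (by positivity) ?_
  have h1 : (N : ℝ) ≤ B * (w + 1 : ℕ) := by exact_mod_cast hNw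
  calc (N : ℝ) ^ (2 * (k - 1)) * (1 / 2) ^ w
      ≤ (B * (w + 1 : ℕ)) ^ (2 * (k - 1)) * (1 / 2) ^ w := by gcongr
    _ = (B : ℝ) ^ (2 * (k - 1)) * ((w + 1 : ℕ) : ℝ) ^ (2 * (k - 1)) * (1 / 2) ^ w := by
        rw [mul_pow]
    _ ≤ (B : ℝ) ^ (2 * (k - 1)) * (K * 2 ^ (w + 1)) * (1 / 2) ^ w := by
        gcongr
        exact hpoly _
    _ = _ := by
        have : (2 : ℝ) ^ w * (1 / 2) ^ w = 1 := by rw [← mul_pow]; norm_num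
        rw [pow_succ]
        linear_combination (2 * (B : ℝ) ^ (2 * (k - 1)) * K) * this

/-- Here `d` is only of order at least √N, which doubles the degree of the polynomial that 2^d must
dominate. -/
lemma mul_two_pow_inv_le_rate {k s N d B : ℕ} {K : ℝ} (hN : 1 ≤ N) (hK : 0 ≤ K)
    (hNd : N ≤ B * d ^ 2) (hpoly : ∀ n : ℕ, (n : ℝ) ^ (2 * (2 * (k - 1) + 1)) ≤ K * 2 ^ n) :
    N * (1 / 2 : ℝ) ^ d ≤ (B : ℝ) ^ (2 * (k - 1) + 1) * K * rate k s N := by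
  refine le_rate_of_pow_mul_le hN (by positivity) ?_
  have h1 : (N : ℝ) ≤ B * (d : ℝ) ^ 2 := by exact_mod_cast hNd
  calc (N : ℝ) ^ (2 * (k - 1)) * (N * (1 / 2) ^ d)
      = (N : ℝ) ^ (2 * (k - 1) + 1) * (1 / 2) ^ d := by ring
    _ ≤ (B * (d : ℝ) ^ 2) ^ (2 * (k - 1) + 1) * (1 / 2) ^ d := by gcongr
    _ = (B : ℝ) ^ (2 * (k - 1) + 1) * (d : ℝ) ^ (2 * (2 * (k - 1) + 1)) * (1 / 2) ^ d := by
        rw [mul_pow, ← pow_mul]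
    _ ≤ (B : ℝ) ^ (2 * (k - 1) + 1) * (K * 2 ^ d) * (1 / 2) ^ d := by
        gcongr
        exact hpoly _
    _ = _ := by
        have : (2 : ℝ) ^ d * (1 / 2) ^ d = 1 := by rw [← mul_pow]; norm_num
        linear_combination ((B : ℝ) ^ (2 * (k - 1) + 1) * K) * this

open scoped Classical in
/-- The contribution of separated pairs. -/
lemma sum_card_separated_le {k s n q Δ C B : ℕ} (hk₁ : 2 ≤ k₁) (hk₂ : 2 ≤ k₂) (hk : 1 ≤ k)
    (hV : 1 ≤ Fintype.card V) (hΔ : 6 * (Δ * Δ) ≤ q) (hq : 2 * k ≤ q)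
    (hM : M ≤ C * Fintype.card V) (hB : Fintype.card V ≤ B * q) :
    (∑ T ∈ (univ : Finset (Finset V)).filter (fun T => #T ≤ s), ∑ u : V, ∑ v : V,
        #((coreSets V k₁ k₂ M).filter (Separated T u v n q Δ 0)) : ℝ) ≤
      (s + 1) * (4 * k * C * (B : ℝ) ^ 2) ^ (2 * k) * rate k s (Fintype.card V) *
        #(coreSets V k₁ k₂ M) := by
  set N := Fintype.card V with hNdef
  set c : ℝ := 4 * k * C * (B : ℝ) ^ 2 with hc
  have hN0 : (0 : ℝ) < N := by exact_mod_cast hV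
  have hq0 : (0 : ℝ) < q := by exact_mod_cast (by omega : 0 < q)
  have hB' : (N : ℝ) ≤ B * q := by exact_mod_cast hB
  have hM' : (M : ℝ) ≤ C * N := by exact_mod_cast hM
  have hone : ∀ T u v, (#((coreSets V k₁ k₂ M).filter (Separated T u v n q Δ 0)) : ℝ) ≤
      (c / N) ^ (2 * k) * #(coreSets V k₁ k₂ M) := by
    intro T u v
    have h := card_separated_zero_le (V := V) (k₁ := k₁) (k₂ := k₂) (M := M) (T := T) (u := u)
      (v := v) (n := n) hk₁ hk₂ hΔ hq
    have h' : (#((coreSets V k₁ k₂ M).filter (Separated T u v n q Δ 0)) : ℝ) *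
        ((q : ℝ) * q) ^ (2 * k) ≤ #(coreSets V k₁ k₂ M) * (2 * ((2 * k : ℕ) * M)) ^ (2 * k) := by
      exact_mod_cast h
    have h2 : (2 * ((2 * k : ℕ) * M) : ℝ) ≤ c / N * (q * q) := by
      rw [div_mul_eq_mul_div, le_div_iff₀ hN0, hc]
      push_cast
      calc 2 * (2 * k * M) * (N : ℝ) ≤ 2 * (2 * k * (C * N)) * N := by gcongr
        _ = 4 * k * C * (N * N) := by ring
        _ ≤ 4 * k * C * ((B * q) * (B * q)) := by gcongr
        _ = _ := by ring
    have h3 : (#((coreSets V k₁ k₂ M).filter (Separated T u v n q Δ 0)) : ℝ) *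
        ((q : ℝ) * q) ^ (2 * k) ≤
        ((c / N) ^ (2 * k) * #(coreSets V k₁ k₂ M)) * ((q : ℝ) * q) ^ (2 * k) := by
      calc _ ≤ _ := h'
        _ ≤ #(coreSets V k₁ k₂ M) * (c / N * (q * q)) ^ (2 * k) := by gcongr
        _ = _ := by rw [mul_pow]; ring
    exact le_of_mul_le_mul_right h3 (by positivity)
  have hcard : (#((univ : Finset (Finset V)).filter fun T => #T ≤ s) : ℝ) ≤
      (s + 1) * (N : ℝ) ^ s := by exact_mod_cast card_filter_card_le hV
  calc (∑ T ∈ (univ : Finset (Finset V)).filter (fun T => #T ≤ s), ∑ u : V, ∑ v : V,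
        #((coreSets V k₁ k₂ M).filter (Separated T u v n q Δ 0)) : ℝ)
      ≤ ∑ T ∈ (univ : Finset (Finset V)).filter (fun T => #T ≤ s), ∑ u : V, ∑ v : V,
        (c / N) ^ (2 * k) * #(coreSets V k₁ k₂ M) :=
        sum_le_sum fun T _ => sum_le_sum fun u _ => sum_le_sum fun v _ => hone T u v
    _ = #((univ : Finset (Finset V)).filter fun T => #T ≤ s) *
          ((N : ℝ) ^ 2 * ((c / N) ^ (2 * k) * #(coreSets V k₁ k₂ M))) := by
        simp only [sum_const, card_univ, nsmul_eq_mul, ← hNdef]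
        ring
    _ ≤ ((s + 1) * (N : ℝ) ^ s) *
          ((N : ℝ) ^ 2 * ((c / N) ^ (2 * k) * #(coreSets V k₁ k₂ M))) := by gcongr
    _ = _ := by
        obtain ⟨l, rfl⟩ : ∃ l, k = l + 1 := ⟨k - 1, by omega⟩
        rw [rate, div_pow]
        simp only [Nat.add_sub_cancel]
        -- Two of the `2 * k` factors 1/N pay for the choice of `u` and `v`; the other `2 * (k - 1)`
        -- form the rate.
        rw [show 2 * (l + 1) = 2 * l + 2 by ring, pow_add (N : ℝ)]
        field_simp

open scoped Classical in
/-- The contribution of small sets that can be left only through few vertices. -/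
lemma card_hasTrap_le_rate {k s L C : ℕ} (hk₁ : 2 ≤ k₁) (hk₂ : 2 ≤ k₂) (hk : k ≤ k₂)
    (hN : 8 * (C + k₁ + k₂ + k₁ * k₂ + 2) ≤ Fintype.card V) (hM : M ≤ C * Fintype.card V)
    (hL : 4 * (k₂ * L) ≤ Fintype.card V)
    (hL' : 4 * (3 * ((s + 1) * edgeConst k₁ k₂ C) ^ 2 * L) ≤ Fintype.card V) :
    (#((coreSets V k₁ k₂ M).filter (HasTrap s L)) : ℝ) ≤
      2 * (64 * (3 * ((s + 1) * edgeConst k₁ k₂ C : ℝ) ^ 2) ^ 2) ^ (k₂ - 1) *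
        rate k s (Fintype.card V) * #(coreSets V k₁ k₂ M) := by
  refine (card_hasTrap_le hk₁ hk₂ hN hM hL hL').trans ?_
  have hN1 : (1 : ℝ) ≤ Fintype.card V := by exact_mod_cast (by omega : 1 ≤ Fintype.card V)
  rw [rate, mul_div_assoc]
  gcongr 2 * _ * (_ / ?_) * _
  exact pow_le_pow_right₀ hN1 (by omega)

-- The scales are balanced here: `w` and `q` linear in N, so that frontiers are large, and `Δ` of
-- order √N, small enough that `6 * Δ²` stays below `q` and large enough that larger degrees are
-- super-polynomially rare.
open scoped Classical in
theorem exists_card_separable_le (hk₁ : 2 ≤ k₁) (hk₂ : 2 ≤ k₂) (C : ℕ) {s : ℕ}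
    (hs : s < min k₁ k₂) :
    ∃ (K : ℝ) (N₀ : ℕ), ∀ N M : ℕ, N₀ ≤ N → M ≤ C * N →
      (#((coreSets (Fin N) k₁ k₂ M).filter (Separable s)) : ℝ) ≤
        K * rate (min k₁ k₂) s N * #(coreSets (Fin N) k₁ k₂ M) := by
  set k := min k₁ k₂ with hk
  have hkk₁ : k ≤ k₁ := min_le_left _ _
  have hkk₂ : k ≤ k₂ := min_le_right _ _
  set a := edgeConst k₁ k₂ C with ha
  have ha' : edgeConst k₂ k₁ C = a := edgeConst_comm _ _ _
  have ha1 : 1 ≤ a := by rw [ha, edgeConst]; omega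
  obtain ⟨K₁, hK₁, hpoly₁⟩ := exists_pow_le_mul_two_pow (2 * (k - 1))
  obtain ⟨K₂, hK₂, hpoly₂⟩ := exists_pow_le_mul_two_pow (2 * (2 * (k - 1) + 1))
  -- Each summand is the coefficient of one requirement of the form `b * w ≤ N`: the admissible
  -- numbers of prescribed edges, the trap bound, the expansion bound.
  set B := 8 * k₁ + 8 * k₂ + 24 * ((s + 1) * a) ^ 2 + 1094 * a ^ 4 with hB
  -- Lower bound for `w`: the first term gives `6 * a ≤ Δ`, since 432 = 2 · 6 · 36; the next two
  -- give `q + s ≤ w` and `2 * k ≤ q`.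
  set W := 432 * (a * a) + 2 * s + 4 * k + 12 with hW
  refine ⟨2 * (64 * (3 * ((s + 1) * a : ℝ) ^ 2) ^ 2) ^ (k₂ - 1) +
    2 * (64 * (3 * ((s + 1) * a : ℝ) ^ 2) ^ 2) ^ (k₁ - 1) +
    2 * (B : ℝ) ^ (2 * (k - 1)) * K₁ + 2 * (B : ℝ) ^ (2 * (k - 1)) * K₁ +
    ((14 * B : ℕ) : ℝ) ^ (2 * (k - 1) + 1) * K₂ + ((14 * B : ℕ) : ℝ) ^ (2 * (k - 1) + 1) * K₂ +
    (s + 1) * (4 * k * C * ((4 * B : ℕ) : ℝ) ^ 2) ^ (2 * k),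
    B * W + 8 * (C + k₁ + k₂ + k₁ * k₂ + 2) + s, fun N M hN hM => ?_⟩
  have hV : Fintype.card (Fin N) = N := Fintype.card_fin N
  have hB16 : 16 ≤ B := by omega
  set w := N / B with hw
  have hwN : B * w ≤ N := Nat.mul_div_le N B
  have hNw : N ≤ B * (w + 1) := (Nat.lt_mul_div_succ N (by omega)).le
  have hWw : W ≤ w := by
    rw [hw, Nat.le_div_iff_mul_le (by omega), mul_comm]
    omega
  set q := w / 2 with hq
  set Δ := Nat.sqrt (q / 6) with hΔ
  have hΔ1 : Δ * Δ ≤ q / 6 := Nat.sqrt_le _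
  have hΔ2 : q / 6 < (Δ + 1) * (Δ + 1) := Nat.lt_succ_sqrt _
  have haΔ : 6 * a ≤ Δ := by
    rw [hΔ, Nat.le_sqrt]
    have : 6 * a * (6 * a) = 36 * (a * a) := by ring
    omega
  have hΔΔ : Δ ≤ Δ * Δ := Nat.le_mul_self Δ
  have hle : ∀ b, b ≤ B → b * w ≤ N := fun b hb => (Nat.mul_le_mul_right _ hb).trans hwN
  have hb1 : 4 * (k₂ * (2 * w)) ≤ N := by
    have := hle (8 * k₂) (by omega)
    calc _ = 8 * k₂ * w := by ring
      _ ≤ N := this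
  have hb2 : 4 * (k₁ * (2 * w)) ≤ N := by
    have := hle (8 * k₁) (by omega)
    calc _ = 8 * k₁ * w := by ring
      _ ≤ N := this
  have hb3 : 4 * (3 * ((s + 1) * a) ^ 2 * (2 * w)) ≤ N := by
    have := hle (24 * ((s + 1) * a) ^ 2) (by omega)
    calc _ = 24 * ((s + 1) * a) ^ 2 * w := by ring
      _ ≤ N := this
  have hb4 : 1094 * (a ^ 4 * w) ≤ N := by
    have := hle (1094 * a ^ 4) (by omega)
    calc _ = 1094 * a ^ 4 * w := by ring
      _ ≤ N := this
  have hb5 : 8 * (k₂ * w) ≤ N := by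
    calc _ = 4 * (k₂ * (2 * w)) := by ring
      _ ≤ N := hb1
  have hb6 : 8 * (k₁ * w) ≤ N := by
    calc _ = 4 * (k₁ * (2 * w)) := by ring
      _ ≤ N := hb2
  have h16 := hle 16 hB16
  have hN1 : 8 * (C + k₁ + k₂ + k₁ * k₂ + 2) ≤ N := by omega
  have hN2 : 8 * (C + k₂ + k₁ + k₂ * k₁ + 2) ≤ N := by
    rw [mul_comm k₂ k₁]; omega
  have hNq : N ≤ 4 * B * q := by
    calc N ≤ B * (w + 1) := hNw
      _ ≤ B * (4 * q) := Nat.mul_le_mul_left _ (by omega)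
      _ = _ := by ring
  have hNΔ : N ≤ 14 * B * (Δ + 1) ^ 2 := by
    have h1 : w + 1 ≤ 14 * (Δ + 1) ^ 2 := by
      have : (Δ + 1) ^ 2 = (Δ + 1) * (Δ + 1) := sq _
      omega
    calc N ≤ B * (w + 1) := hNw
      _ ≤ B * (14 * (Δ + 1) ^ 2) := Nat.mul_le_mul_left _ h1
      _ = _ := by ring
  have hcomm : #(coreSets (Fin N) k₂ k₁ M) = #(coreSets (Fin N) k₁ k₂ M) := card_coreSets_comm
  have e0 := card_separable_le (V := Fin N) (k₁ := k₁) (k₂ := k₂) (M := M) (s := s) (w := w)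
    (q := q) (Δ := Δ) (by omega) (by omega) (by rw [hV]; omega) (by rw [hV]; omega) (by omega)
  have e1 := card_hasTrap_le_rate (V := Fin N) (M := M) (s := s) (L := 2 * w) hk₁ hk₂ hkk₂
    (by rw [hV]; exact hN1) (by rw [hV]; exact hM) (by rw [hV]; exact hb1)
    (by rw [hV]; exact hb3)
  have e2 := card_hasTrap_le_rate (V := Fin N) (M := M) (s := s) (L := 2 * w) hk₂ hk₁ hkk₁
    (by rw [hV]; exact hN2) (by rw [hV]; exact hM) (by rw [hV]; exact hb2)
    (by rw [hV, ha']; exact hb3)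
  have e3 := card_expandsPoorly_le (V := Fin N) (M := M) (w := w) hk₁ hk₂
    (by rw [hV]; exact hN1) (by rw [hV]; exact hM) (by rw [hV]; exact hb5)
    (by rw [hV]; exact hb4)
  have e4 := card_expandsPoorly_le (V := Fin N) (M := M) (w := w) hk₂ hk₁
    (by rw [hV]; exact hN2) (by rw [hV]; exact hM) (by rw [hV]; exact hb6)
    (by rw [hV, ha']; exact hb4)
  have e5 := card_hasLargeOutDegree_le (V := Fin N) (k₂ := k₂) (M := M) (d := Δ + 1) hk₁
    (by rw [hV]; exact hN1) (by rw [hV]; exact hM) (by rw [hV]; omega) (by omega)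
  have e6 := card_hasLargeOutDegree_le (V := Fin N) (k₂ := k₁) (M := M) (d := Δ + 1) hk₂
    (by rw [hV]; exact hN2) (by rw [hV]; exact hM) (by rw [hV]; omega) (by rw [ha']; omega)
  have e7 := sum_card_separated_le (V := Fin N) (k₁ := k₁) (k₂ := k₂) (M := M) (k := k) (s := s)
    (n := 2 * w) (q := q) (Δ := Δ) (C := C) (B := 4 * B) hk₁ hk₂ (by omega)
    (by rw [hV]; omega) (by omega) (by omega) (by rw [hV]; exact hM) (by rw [hV]; exact hNq)
  rw [hV] at e1 e2 e5 e6 e7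
  rw [hcomm] at e2 e4 e6
  rw [ha'] at e2
  have f1 := two_pow_inv_le_rate (k := k) (s := s) (by omega : 1 ≤ N) hK₁ hNw hpoly₁
  have f2 := mul_two_pow_inv_le_rate (k := k) (s := s) (by omega : 1 ≤ N) hK₂ hNΔ hpoly₂
  set D : ℝ := ((#(coreSets (Fin N) k₁ k₂ M) : ℕ) : ℝ) with hD
  have hD0 : 0 ≤ D := by positivity
  have g1 := mul_le_mul_of_nonneg_right f1 hD0
  have g2 := mul_le_mul_of_nonneg_right f2 hD0
  have e0' := (Nat.cast_le (α := ℝ)).2 e0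
  push_cast at e0'
  push_cast at e7 g2 ⊢
  linarith

end Assembly

/-! ### Passage to digraphs and existence of cores -/

section Transfer

/-- The digraph with a given edge set. -/
def toDigraph {V : Type*} (E : Finset (V × V)) : Digraph V := ⟨fun u v => (u, v) ∈ E⟩

lemma toDigraph_injective {V : Type*} :
    Function.Injective (toDigraph : Finset (V × V) → Digraph V) := by
  intro E E' h
  ext ⟨a, b⟩
  have := congrArg (fun D => Digraph.Adj D a b) h
  exact iff_of_eq this

lemma outDeg_toDigraph {V : Type*} [DecidableEq V] [Fintype V] (E : Finset (V × V)) (v : V) :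
    (toDigraph E).outDeg v = outDegree E v := by
  rw [outDegree_eq_card, Digraph.outDeg, ← Set.ncard_coe_finset]
  congr 1
  ext; simp [toDigraph]

lemma inDeg_toDigraph {V : Type*} [DecidableEq V] [Fintype V] (E : Finset (V × V)) (v : V) :
    (toDigraph E).inDeg v = inDegree E v := by
  rw [inDegree_eq_card, Digraph.inDeg, ← Set.ncard_coe_finset]
  congr 1
  ext; simp [toDigraph]

lemma ncard_edges_toDigraph {V : Type*} (E : Finset (V × V)) :
    (toDigraph E).edges.ncard = #E := by
  rw [← Set.ncard_coe_finset]
  rfl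

variable {k₁ k₂ N M : ℕ}

lemma toDigraph_mem_simpleDicores {E : Finset (Fin N × Fin N)} :
    toDigraph E ∈ simpleDicores k₁ k₂ N M ↔ E ∈ coreSets (Fin N) k₁ k₂ M := by
  rw [mem_coreSets]
  change (toDigraph E).IsSimple ∧ (toDigraph E).IsDicore k₁ k₂ ∧ (toDigraph E).edges.ncard = M ↔ _
  rw [ncard_edges_toDigraph, Digraph.IsDicore]
  simp only [outDeg_toDigraph, inDeg_toDigraph]
  refine and_congr_left fun _ => ⟨?_, ?_⟩
  · rintro h ⟨a, b⟩ he hab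
    obtain rfl : a = b := hab
    exact h a he
  · exact fun h v hv => h (v, v) hv rfl

lemma exists_toDigraph_eq (D : Digraph (Fin N)) : ∃ E, toDigraph E = D := by
  classical
  refine ⟨univ.filter fun e => D.Adj e.1 e.2, ?_⟩
  ext a b
  simp [toDigraph]

open scoped Classical in
lemma ncard_sep_simpleDicores (P : Digraph (Fin N) → Prop) :
    {D ∈ simpleDicores k₁ k₂ N M | P D}.ncard =
      #((coreSets (Fin N) k₁ k₂ M).filter fun E => P (toDigraph E)) := by
  rw [← Set.ncard_coe_finset, ← Set.ncard_image_of_injective _ toDigraph_injective]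
  congr 1
  ext D
  obtain ⟨E, rfl⟩ := exists_toDigraph_eq D
  simp [toDigraph_mem_simpleDicores, toDigraph_injective.eq_iff]

lemma ncard_simpleDicores : (simpleDicores k₁ k₂ N M).ncard = #(coreSets (Fin N) k₁ k₂ M) := by
  simpa using ncard_sep_simpleDicores (k₁ := k₁) (k₂ := k₂) (N := N) (M := M) fun _ => True

open scoped Classical in
lemma one_sub_le_dicoreProb {P : Digraph (Fin N) → Prop} {Q : Finset (Fin N × Fin N) → Prop}
    {δ : ℝ} (hne : (coreSets (Fin N) k₁ k₂ M).Nonempty)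
    (hP : ∀ E ∈ coreSets (Fin N) k₁ k₂ M, ¬ Q E → P (toDigraph E))
    (hQ : (#((coreSets (Fin N) k₁ k₂ M).filter Q) : ℝ) ≤ δ * #(coreSets (Fin N) k₁ k₂ M)) :
    1 - δ ≤ dicoreProb k₁ k₂ N M P := by
  rw [dicoreProb, ncard_sep_simpleDicores, ncard_simpleDicores]
  have h0 : (0 : ℝ) < #(coreSets (Fin N) k₁ k₂ M) := by exact_mod_cast hne.card_pos
  rw [le_div_iff₀ h0]
  have h1 : #(coreSets (Fin N) k₁ k₂ M) ≤ #((coreSets (Fin N) k₁ k₂ M).filter Q) +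
      #((coreSets (Fin N) k₁ k₂ M).filter fun E => P (toDigraph E)) := by
    refine le_trans (card_le_card ?_) (card_union_le _ _)
    intro E hE
    simp only [mem_union, mem_filter, hE, true_and]
    by_cases h : Q E
    · exact Or.inl h
    · exact Or.inr (hP E hE h)
  have h2 : (#(coreSets (Fin N) k₁ k₂ M) : ℝ) ≤ #((coreSets (Fin N) k₁ k₂ M).filter Q) +
      #((coreSets (Fin N) k₁ k₂ M).filter fun E => P (toDigraph E)) := by exact_mod_cast h1
  linarith

lemma isStronglyConnected_of_not_separable {V : Type*} [DecidableEq V] {E : Finset (V × V)}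
    (h : ¬ Separable 0 E) : (toDigraph E).IsStronglyConnected := by
  intro u v
  by_contra huv
  refine h ⟨∅, by simp, u, by simp, v, by simp, fun hr =>
    huv (Relation.ReflTransGen.mono (fun a b hab => hab.2.2) _ _ hr)⟩

lemma isKStronglyConnected_of_not_separable {V : Type*} [DecidableEq V] {E : Finset (V × V)}
    {k : ℕ} (hk : k < Nat.card V) (hk0 : 1 ≤ k) (h : ¬ Separable (k - 1) E) :
    (toDigraph E).IsKStronglyConnected k := by
  refine ⟨hk, fun T hT => ?_⟩
  rintro ⟨u, hu⟩ ⟨v, hv⟩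
  have huv : Relation.ReflTransGen (AdjAvoiding E T) u v := by
    by_contra huv
    exact h ⟨T, by omega, u, hu, v, hv, huv⟩
  induction huv with
  | refl => exact .refl
  | tail _ hbc ih => exact (ih hbc.1).tail hbc.2.2

/-- Circulant digraphs supplemented by arbitrary edges are cores. -/
lemma coreSets_nonempty {K : ℕ} (hk₁ : k₁ ≤ K) (hk₂ : k₂ ≤ K) (hKN : K < N) (hM : K * N ≤ M)
    (hM' : M ≤ N * N - N) : (coreSets (Fin N) k₁ k₂ M).Nonempty := by
  have : NeZero N := ⟨by omega⟩
  -- The differences 1, …, K modulo N; as K < N they are K distinct nonzero residues.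
  set S : Finset (Fin N) := univ.filter fun j => j.val ∈ Icc 1 K with hS
  have hSc : #S = K := by
    have : S.map Fin.valEmbedding = Icc 1 K := by
      ext j
      simp only [hS, mem_map, mem_filter, mem_univ, true_and, Fin.valEmbedding_apply]
      constructor
      · rintro ⟨a, ha, rfl⟩; exact ha
      · intro hj
        exact ⟨⟨j, by have := (mem_Icc.1 hj).2; omega⟩, hj, rfl⟩
    rw [← card_map Fin.valEmbedding, this, Nat.card_Icc]
    omega
  set E₀ : Finset (Fin N × Fin N) := univ.filter fun e => e.2 - e.1 ∈ S with hE₀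
  have hout : ∀ u, outDegree E₀ u = K := by
    intro u
    rw [outDegree_eq_card, ← hSc]
    refine card_bij (fun y _ => y - u) ?_ ?_ ?_
    · intro y hy; simpa [hE₀] using hy
    · intro a _ b _ h; simpa using h
    · intro j hj; exact ⟨j + u, by simpa [hE₀] using hj, by simp⟩
  have hin : ∀ v, inDegree E₀ v = K := by
    intro v
    rw [inDegree_eq_card, ← hSc]
    refine card_bij (fun x _ => v - x) ?_ ?_ ?_
    · intro y hy; simpa [hE₀] using hy
    · intro a _ b _ h; simpa using h
    · intro j hj; exact ⟨v - j, by simpa [hE₀] using hj, by simp⟩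
  have hcard : #E₀ = K * N := by
    have h := card_filter_fst_mem E₀ univ
    simp only [mem_univ, filter_true, hout, sum_const, card_univ, Fintype.card_fin,
      smul_eq_mul] at h
    rw [h, mul_comm]
  have hloop : E₀ ⊆ (univ : Finset (Fin N)).offDiag := by
    rintro ⟨a, b⟩ h
    simp only [mem_offDiag, mem_univ, true_and]
    rintro rfl
    simp [hE₀, hS] at h
  obtain ⟨E, hE₀E, hE, hEc⟩ := exists_subsuperset_card_eq hloop (hcard.trans_le hM)
    (by rw [offDiag_card, card_univ, Fintype.card_fin]; exact hM')
  refine ⟨E, mem_coreSets.2 ⟨fun e he => (mem_offDiag.1 (hE he)).2.2, fun v => ⟨?_, ?_⟩, hEc⟩⟩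
  · exact (hk₁.trans (hin v).ge).trans (card_le_card (filter_subset_filter _ hE₀E))
  · exact (hk₂.trans (hout v).ge).trans (card_le_card (filter_subset_filter _ hE₀E))

end Transfer

end DirectedCore

theorem theorem1 (k₁ k₂ : ℕ) (hk₁ : 2 ≤ k₁) (hk₂ : 2 ≤ k₂) (ε C : ℝ) (hε : 0 < ε) :
    ∃ (K : ℝ) (N₀ : ℕ), ∀ N M : ℕ, N₀ ≤ N →
      ((max k₁ k₂ : ℕ) + ε) * (N : ℝ) ≤ (M : ℝ) → (M : ℝ) ≤ C * (N : ℝ) →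
        (simpleDicores k₁ k₂ N M).Nonempty ∧
        1 - K / (N : ℝ) ^ (2 * (min k₁ k₂ - 1)) ≤
          dicoreProb k₁ k₂ N M (fun D => D.IsStronglyConnected) ∧
        1 - K / (N : ℝ) ^ (min k₁ k₂ - 1) ≤
          dicoreProb k₁ k₂ N M (fun D => D.IsKStronglyConnected (min k₁ k₂)) := by
  classical
  -- Deleting nothing (`s = 0`) governs strong connectivity; deleting at most `k - 1` vertices
  -- governs `k`-strong connectivity.
  obtain ⟨K₁, N₁, h₁⟩ := DirectedCore.exists_card_separable_le hk₁ hk₂ ⌈C⌉₊ (s := 0) (by omega)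
  obtain ⟨K₂, N₂, h₂⟩ := DirectedCore.exists_card_separable_le hk₁ hk₂ ⌈C⌉₊
    (s := min k₁ k₂ - 1) (by omega)
  refine ⟨max K₁ K₂, N₁ + N₂ + ⌈C⌉₊ + max k₁ k₂ + 1, fun N M hN hMlow hMup => ?_⟩
  have hN0 : (0 : ℝ) < N := by exact_mod_cast (by omega : 0 < N)
  have hMC : M ≤ ⌈C⌉₊ * N := by
    have : (M : ℝ) ≤ ⌈C⌉₊ * N := hMup.trans (by gcongr; exact Nat.le_ceil C)
    exact_mod_cast this
  have hKM : max k₁ k₂ * N ≤ M := by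
    have : ((max k₁ k₂ : ℕ) : ℝ) * N ≤ M := by
      refine le_trans ?_ hMlow
      gcongr
      linarith
    exact_mod_cast this
  have hMN : M ≤ N * N - N := by
    have h : (⌈C⌉₊ + 1) * N ≤ N * N := Nat.mul_le_mul_right _ (by omega)
    rw [add_mul, one_mul] at h
    omega
  have hne : (DirectedCore.coreSets (Fin N) k₁ k₂ M).Nonempty :=
    DirectedCore.coreSets_nonempty (le_max_left _ _) (le_max_right _ _) (by omega) hKM hMN
  refine ⟨?_, ?_, ?_⟩
  · obtain ⟨E, hE⟩ := hne
    exact ⟨_, DirectedCore.toDigraph_mem_simpleDicores.2 hE⟩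
  · refine DirectedCore.one_sub_le_dicoreProb hne
      (fun E _ h => DirectedCore.isStronglyConnected_of_not_separable h)
      ((h₁ N M (by omega) hMC).trans ?_)
    gcongr
    rw [DirectedCore.rate, pow_zero, mul_one_div]
    gcongr
    exact le_max_left _ _
  · refine DirectedCore.one_sub_le_dicoreProb hne
      (fun E _ h => DirectedCore.isKStronglyConnected_of_not_separable
        (by rw [Nat.card_fin]; omega) (by omega) h)
      ((h₂ N M (by omega) hMC).trans ?_)
    gcongr
    -- At `s = k - 1` the rate is N^(k-1) / N^(2(k-1)), and half of the exponent cancels.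
    rw [DirectedCore.rate, two_mul, pow_add, div_mul_cancel_left₀ (by positivity),
      ← div_eq_mul_inv]
    gcongr
    exact le_max_right _ _
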